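/- **Theorem (asymptotic $L^p$ moments of $\hat r_\phi$).** Let $m\ge 1$, let $X,Z$ be random vectors in $\mathbb R^d$ with supports $\mathcal X$ and $\mathcal Z\subset\mathcal X$, and let $\phi:\mathcal X\to\mathbb R^m$ be measurable. Suppose that the laws $\nu_0$ of $\phi(X)$ and $\nu_1$ of $\phi(Z)$ have densities $f_0,f_1$ with respect to Lebesgue measure on $\mathbb R^m$ and that $\nu_1\ll\nu_0$; put $r=f_1/f_0$. Let $X_1,\dots,X_{N_0}$ be independent copies of $X$ and $Z_1,\dots,Z_{N_1}$ independent copies of $Z$, all mutually independent. Let $N_1=N_1(N_0)$ and $M=M(N_0)$ be sequences of nonnegative integers. For $x\in\mathcal X$ let $\hat\phi$ be an estimator of the function $\phi$, that is, a (jointly measurable) function of the evaluation point and the data $X_1,\dots,X_{N_0},Z_1,\dots,Z_{N_1}$, which may also depend on $x$. Let $\hat\Phi_M(z)$ be the $M$-th smallest of $\|\hat\phi(X_i)-\hat\phi(z)\|$, $i=1,\dots,N_0$, and put $$A_\phi(x)=\{z\in\mathcal Z:\|\hat\phi(x)-\hat\phi(z)\|\le\hat\Phi_M(z)\},\qquad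 K_\phi(x)=\sum_{j=1}^{N_1}\mathbf 1(Z_j\in A_\phi(x)),\qquad \hat r_\phi(x)=\frac{N_0}{N_1}\frac{K_\phi(x)}{M}.$$ Let $p\ge1$ be an integer. For $z\in\mathcal Z^p$ let $\hat\phi_{(Z_1,\dots,Z_p)\to z}$ be the estimator computed after replacing $(Z_1,\dots,Z_p)$ by $z$, and write $\|\psi\|_\infty=\sup_{s\in\mathcal X}\|\psi(s)\|$. Assume that one of the following holds. (a) For some integer $q$ with $1\le q\le m$ (for instance $q=m$), $$\lim_{N_0\to\infty}E\Big[\Big(\frac{N_0}{M}\Big)^p\sup_{z\in\mathcal Z^p}\|\hat\phi_{(Z_1,\dots,Z_p)\to z}-\phi\|_\infty^{pq}\Big]=0 .$$ (b) For every $\epsilon>0$ there are functions $T_\epsilon=T_{\epsilon,N_0}:(0,\infty)\to[0,\infty]$ such that for all $u>0$ and all $N_0$ $$P\Big(\sup_{\delta\ge u}\delta^{-1}\sup_{s,t\in\mathcal X:\|\phi(s)-\phi(t)\|\le\delta}\ \sup_{z\in\mathcal Z^p}\|(\hat\phi_{(Z_1,\dots,Z_p)\to z}-\phi)(s)-(\hat\phi_{(Z_1,\dots,Z_p)\to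 z}-\phi)(t)\|>\epsilon\Big)\le T_\epsilon(u),$$ $$\lim_{N_0\to\infty}\Big(\frac{N_0}{M}\Big)^k\int_0^\infty u^{k-1}T_\epsilon(u^{1/m})\,du=0\quad(k=1,\dots,p),\qquad \lim_{N_0\to\infty}\Big(\frac{N_0}{M}\Big)^pP\big(\|\hat\phi-\phi\|_\infty>\epsilon\big)=0 .$$ If $M\log N_0/N_0\to0$, $MN_1/N_0\to\infty$ and $M\to\infty$ as $N_0\to\infty$, then $$\lim_{N_0\to\infty}E\big[\hat r_\phi(x)^p\big]=r(\phi(x))^p$$ for every $x\in\mathcal X$ such that $f_0(\phi(x))>0$ and $f_0,f_1$ are continuous at $\phi(x)$. -/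

import Mathlib

open MeasureTheory ProbabilityTheory Filter Topology
open scoped ENNReal NNReal

namespace MatchingRatio

noncomputable section

/-- The Euclidean space `ℝᵏ`. -/
abbrev E (k : ℕ) : Type := EuclideanSpace ℝ (Fin k)

/-- The `k`-th order statistic (`k`-th smallest entry, `1 ≤ k ≤ N`, counted with multiplicity)
of a finite real sample. Outside the range `1 ≤ k ≤ N` the value is irrelevant. -/
def orderStat {N : ℕ} (v : Fin N → ℝ) (k : ℕ) : ℝ :=
  if h : k - 1 < N then v (Tuple.sort v ⟨k - 1, h⟩) else 0

/-- The sample `zs` in which the first `p` observations are replaced by the points `z`. -/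
def replaceFirst {α : Type*} {N p : ℕ} (zs : Fin N → α) (z : Fin p → α) : Fin N → α :=
  fun j => if h : (j : ℕ) < p then z ⟨j, h⟩ else zs j

variable {d m : ℕ}

/-- The radius `Φ̂_M(z)`: the `M`-th order statistic of the distances `‖φ̂(Xᵢ) - φ̂(z)‖`,
`i = 1, …, N₀`. -/
def matchRadius {N₀ : ℕ} (M : ℕ) (φh : E d → E m) (xs : Fin N₀ → E d) (z : E d) : ℝ :=
  orderStat (fun i => ‖φh (xs i) - φh z‖) M

/-- The catchment area of `x`, a subset of `𝒵`. -/
def catchment {N₀ : ℕ} (𝒵 : Set (E d)) (M : ℕ) (φh : E d → E m) (xs : Fin N₀ → E d) (x : E d) :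
    Set (E d) :=
  {z | z ∈ 𝒵 ∧ ‖φh x - φh z‖ ≤ matchRadius M φh xs z}

/-- The number of matched times of `x`. -/
def matchCount {N₀ N₁ : ℕ} (𝒵 : Set (E d)) (M : ℕ) (φh : E d → E m)
    (xs : Fin N₀ → E d) (zs : Fin N₁ → E d) (x : E d) : ℝ :=
  ∑ j, (catchment 𝒵 M φh xs x).indicator (fun _ => (1 : ℝ)) (zs j)

/-- The matching-based density ratio estimator `(N₀ / N₁) * (K(x) / M)`. -/
def ratioEst {N₀ N₁ : ℕ} (𝒵 : Set (E d)) (M : ℕ) (φh : E d → E m)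
    (xs : Fin N₀ → E d) (zs : Fin N₁ → E d) (x : E d) : ℝ :=
  (N₀ : ℝ) / N₁ * (matchCount 𝒵 M φh xs zs x / M)

/-- An estimation procedure: for each `N₀` and each pair of samples of sizes `N₀` and `N₁(N₀)`,
a transformation of the covariates. -/
abbrev Estimator (d m : ℕ) (N₁ : ℕ → ℕ) : Type :=
  (n : ℕ) → (Fin n → E d) → (Fin (N₁ n) → E d) → E d → E m

/-- The supremum norm `‖ψ - φ‖_∞` over `𝒳`, with values in `[0, ∞]`. -/
def supDist (𝒳 : Set (E d)) (ψ φ : E d → E m) : ℝ≥0∞ :=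
  ⨆ s ∈ 𝒳, ‖ψ s - φ s‖ₑ

section

variable {Ω : Type*} [MeasurableSpace Ω] {N₁ : ℕ → ℕ}

/-- The fitted transformation on the samples `X₁, …, X_{N₀}` and `Z₁, …, Z_{N₁}`. -/
def fitted (φhat : Estimator d m N₁) (X Z : ℕ → Ω → E d) (n : ℕ) (ω : Ω) : E d → E m :=
  φhat n (fun i => X i ω) (fun j => Z j ω)

/-- The fitted transformation after replacing `(Z₁, …, Z_p)` by `z`. -/
def refitted (φhat : Estimator d m N₁) (X Z : ℕ → Ω → E d) {p : ℕ} (z : Fin p → E d)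
    (n : ℕ) (ω : Ω) : E d → E m :=
  φhat n (fun i => X i ω) (replaceFirst (fun j => Z j ω) z)

/-- `sup_{z ∈ 𝒵ᵖ} ‖φ̂_{(Z₁, …, Z_p) → z} - φ‖_∞`. -/
def supError (𝒳 𝒵 : Set (E d)) (φ : E d → E m) (φhat : Estimator d m N₁) (X Z : ℕ → Ω → E d)
    (p n : ℕ) (ω : Ω) : ℝ≥0∞ :=
  ⨆ z : Fin p → E d, ⨆ _ : ∀ k, z k ∈ 𝒵, supDist 𝒳 (refitted φhat X Z z n ω) φ

/-- `E[(N₀/M)ᵖ sup_{z ∈ 𝒵ᵖ} ‖φ̂_{(Z₁, …, Z_p) → z} - φ‖_∞^{pq}] → 0` as `N₀ → ∞`. -/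
def UniformErrorCondition (P : Measure Ω) (𝒳 𝒵 : Set (E d)) (φ : E d → E m)
    (φhat : Estimator d m N₁) (X Z : ℕ → Ω → E d) (M : ℕ → ℕ) (p q : ℕ) : Prop :=
  (∀ n, AEMeasurable (supError 𝒳 𝒵 φ φhat X Z p n) P) ∧
  Tendsto (fun n : ℕ =>
      ∫⁻ ω, ENNReal.ofReal ((n : ℝ) / M n) ^ p * supError 𝒳 𝒵 φ φhat X Z p n ω ^ (p * q) ∂P)
    atTop (𝓝 0)

/-- `sup_{δ ≥ u} δ⁻¹ sup_{s,t ∈ 𝒳 : ‖φ(s) - φ(t)‖ ≤ δ} sup_{z ∈ 𝒵ᵖ}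
‖(φ̂_{(Z₁, …, Z_p) → z} - φ)(s) - (φ̂_{(Z₁, …, Z_p) → z} - φ)(t)‖`. -/
def relOscillation (𝒳 𝒵 : Set (E d)) (φ : E d → E m) (φhat : Estimator d m N₁)
    (X Z : ℕ → Ω → E d) (p n : ℕ) (u : ℝ) (ω : Ω) : ℝ≥0∞ :=
  ⨆ δ : ℝ, ⨆ _ : u ≤ δ, ENNReal.ofReal δ⁻¹ *
    ⨆ s ∈ 𝒳, ⨆ t ∈ 𝒳, ⨆ _ : ‖φ s - φ t‖ ≤ δ,
      ⨆ z : Fin p → E d, ⨆ _ : ∀ k, z k ∈ 𝒵,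
        ‖(refitted φhat X Z z n ω s - φ s) - (refitted φhat X Z z n ω t - φ t)‖ₑ

/-- For every `ε > 0`: the relative oscillation exceeds `ε` with probability at most `T_ε(u)`, where
`(N₀/M)ᵏ ∫₀^∞ u^{k-1} T_ε(u^{1/m}) du → 0` for `1 ≤ k ≤ p` (the function `T_ε` may depend on `N₀`),
and `(N₀/M)ᵖ P(‖φ̂ - φ‖_∞ > ε) → 0`. -/
def OscillationCondition (P : Measure Ω) (𝒳 𝒵 : Set (E d)) (φ : E d → E m)
    (φhat : Estimator d m N₁) (X Z : ℕ → Ω → E d) (M : ℕ → ℕ) (p : ℕ) : Prop :=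
  ∀ ε : ℝ, 0 < ε →
    (∃ T : ℕ → ℝ → ℝ≥0∞,
      (∀ n, ∀ u : ℝ, 0 < u →
        P {ω | ENNReal.ofReal ε < relOscillation 𝒳 𝒵 φ φhat X Z p n u ω} ≤ T n u) ∧
      ∀ k ∈ Finset.Icc 1 p,
        Tendsto (fun n : ℕ => ENNReal.ofReal ((n : ℝ) / M n) ^ k *
            ∫⁻ u in Set.Ioi (0 : ℝ), ENNReal.ofReal (u ^ (k - 1)) * T n (u ^ (1 / (m : ℝ))))
          atTop (𝓝 0)) ∧
    Tendsto (fun n : ℕ => ENNReal.ofReal ((n : ℝ) / M n) ^ p *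
        P {ω | ENNReal.ofReal ε < supDist 𝒳 (fitted φhat X Z n ω) φ})
      atTop (𝓝 0)

end

end

end MatchingRatio

namespace MatchingRatio

noncomputable section

/-! A point `z` of `𝒵` is matched to `x` exactly when fewer than `M` of the fitted values at the
`Xᵢ` are strictly closer to the fitted value at `z` than the one at `x` is. So `K(x)` is governed by
how many `φ(Xᵢ)` lie in balls of `ℝᵐ` and how many `φ(Zⱼ)` lie in balls around `φ(x)`, provided that
replacing `φ` by its estimate changes distances little relative to their size. `IncrementBound`
expresses this proviso down to a given scale.

Convergence in probability (`tendsto_measure_abs_ratioEst_sub`): let `H` be the radius for which a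
ball near `φ(x)` is expected to hold about `M` of the `φ(Xᵢ)`. Chebyshev's inequality at finitely
many net centres shows that, up to factors `1 ± 4η` on the radius, the matched `Zⱼ` are those with
`φ(Zⱼ)` in the `H`-ball around `φ(x)`. Counting these, again by Chebyshev, gives `f₁/f₀` at `φ(x)`.

Convergence of moments also needs uniform integrability, supplied by a dominating bound `C + Y` on
the `p`-th power with `∫ Y → 0` (`exists_asymptotic_domination`). The catchment area is localized on
dyadic scales `2ⁱ t`, where `tᵐ` is of order `M/N₀`. If at all scales from `i` up the net balls hold
at least `M` points and the increments are controlled, the matched `φ(Zⱼ)` lie in the ball of radius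
`2ⁱ t` (`norm_lt_of_mem_catchment`). Failure at scale `i` costs the `p`-th power of the expected
count at the next scale. Chernoff bounds make the failures of the net balls summable, and those of
the estimator are summable by `DyadicErrorCondition`, which both alternative assumptions imply.
`tendsto_integral_pow_of_domination` combines the two halves. -/

/-! ### Counting and order statistics. -/

open Classical in
/-- The number of entries of a finite sample lying in a set. -/
def hits {F : Type*} (B : Set F) {N : ℕ} (v : Fin N → F) : ℕ :=
  (Finset.univ.filter fun i => v i ∈ B).card

lemma hits_le_hits {F G : Type*} {B : Set F} {C : Set G} {N : ℕ} {v : Fin N → F} {w : Fin N → G}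
    (h : ∀ i, v i ∈ B → w i ∈ C) : hits B v ≤ hits C w := by
  classical
  exact Finset.card_le_card fun i hi => by
    simp only [Finset.mem_filter, Finset.mem_univ, true_and] at hi ⊢
    exact h i hi

lemma hits_le {F : Type*} (B : Set F) {N : ℕ} (v : Fin N → F) : hits B v ≤ N := by
  classical
  exact (Finset.card_filter_le _ _).trans_eq (by simp)

lemma cast_hits {F : Type*} (B : Set F) {N : ℕ} (v : Fin N → F) :
    (hits B v : ℝ) = ∑ i, B.indicator (fun _ => (1 : ℝ)) (v i) := by
  classical
  simp [hits, Set.indicator_apply]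

/-- After sorting, the entries below `a` form an initial segment, so comparing its length with `k`
decides the inequality. This replaces order statistics by counts everywhere below. -/
lemma le_orderStat_iff {N : ℕ} (v : Fin N → ℝ) {k : ℕ} (hk : 1 ≤ k) (hkN : k ≤ N) (a : ℝ) :
    a ≤ orderStat v k ↔ hits (Set.Iio a) v < k := by
  classical
  have hlt : k - 1 < N := by omega
  have hmono : Monotone (v ∘ Tuple.sort v) := Tuple.monotone_sort v
  have hcard : hits (Set.Iio a) v =
      (Finset.univ.filter fun j => v (Tuple.sort v j) < a).card := by
    unfold hits
    symm
    refine Finset.card_bij (fun j _ => Tuple.sort v j) ?_ ?_ ?_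
    · intro j hj; simpa using hj
    · intro i _ j _ h; exact (Tuple.sort v).injective h
    · intro b hb
      exact ⟨(Tuple.sort v).symm b, by simpa using hb, by simp⟩
  rw [hcard, orderStat, dif_pos hlt]
  constructor
  · intro ha
    have hsub : (Finset.univ.filter fun j => v (Tuple.sort v j) < a) ⊆
        Finset.Iio (⟨k - 1, hlt⟩ : Fin N) := by
      intro j hj
      simp only [Finset.mem_filter, Finset.mem_univ, true_and, Finset.mem_Iio] at hj ⊢
      by_contra hcon
      exact absurd (ha.trans (hmono (not_lt.1 hcon))) (not_le.2 hj)
    have := Finset.card_le_card hsub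
    rw [Fin.card_Iio] at this
    simp only at this
    omega
  · intro hc
    by_contra hcon
    have hsub : Finset.Iic (⟨k - 1, hlt⟩ : Fin N) ⊆
        (Finset.univ.filter fun j => v (Tuple.sort v j) < a) := by
      intro j hj
      simp only [Finset.mem_filter, Finset.mem_univ, true_and, Finset.mem_Iic] at hj ⊢
      exact (hmono hj).trans_lt (not_le.1 hcon)
    have := Finset.card_le_card hsub
    rw [Fin.card_Iic] at this
    simp only at this
    omega

/-! ### Deviation and moment bounds for binomial counts. -/

section Binomial

variable {Ω F : Type*} [MeasurableSpace Ω] [MeasurableSpace F] {P : Measure Ω}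

lemma measurable_hits {N : ℕ} {G : Type*} [MeasurableSpace G] {B : Set F} (hB : MeasurableSet B)
    {v : G → Fin N → F} (hv : Measurable v) : Measurable fun g => (hits B (v g) : ℝ) := by
  simp_rw [cast_hits]
  exact Finset.measurable_sum _ fun i _ =>
    (measurable_const.indicator hB).comp ((measurable_pi_apply i).comp hv)

lemma aemeasurable_hits {V : ℕ → Ω → F} (hV : ∀ i, AEMeasurable (V i) P) {B : Set F}
    (hB : MeasurableSet B) (N : ℕ) :
    AEMeasurable (fun ω => (hits B (fun i : Fin N => V i ω) : ℝ)) P :=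
  (measurable_hits hB measurable_id).comp_aemeasurable
    (aemeasurable_pi_lambda _ fun i : Fin N => hV i)

variable {V : ℕ → Ω → F} {ν : Measure F}

lemma integral_indicator_hasLaw {X : Ω → F} (hX : HasLaw X ν P) {B : Set F}
    (hB : MeasurableSet B) :
    ∫ ω, B.indicator (fun _ => (1 : ℝ)) (X ω) ∂P = ν.real B := by
  rw [← hX.map_eq, ← integral_map (f := B.indicator fun _ => (1 : ℝ)) hX.aemeasurable
    (measurable_const.indicator hB).aestronglyMeasurable, integral_indicator hB]
  simp

variable [IsProbabilityMeasure P]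

lemma integrable_indicator_hasLaw {X : Ω → F} (hX : HasLaw X ν P) {B : Set F}
    (hB : MeasurableSet B) : Integrable (fun ω => B.indicator (fun _ => (1 : ℝ)) (X ω)) P := by
  refine Integrable.of_bound (C := 1) ((measurable_const.indicator hB).comp_aemeasurable
    hX.aemeasurable).aestronglyMeasurable (Eventually.of_forall fun ω => ?_)
  by_cases h : X ω ∈ B <;> simp [h]

lemma integrable_exp_hits (hV : ∀ i, HasLaw (V i) ν P) {B : Set F} (hB : MeasurableSet B)
    (N : ℕ) (s : ℝ) :
    Integrable (fun ω => Real.exp (s * (hits B (fun i : Fin N => V i ω) : ℝ))) P := by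
  refine Integrable.of_bound (C := Real.exp (|s| * N)) (Real.measurable_exp.comp_aemeasurable
    ((aemeasurable_hits (fun i => (hV i).aemeasurable) hB N).const_mul s)).aestronglyMeasurable
    (Eventually.of_forall fun ω => ?_)
  rw [Real.norm_eq_abs, Real.abs_exp, Real.exp_le_exp]
  refine (le_abs_self _).trans ?_
  rw [abs_mul, Nat.abs_cast]
  gcongr
  exact hits_le _ _

/-- Chebyshev's inequality; the variance of each indicator is at most its mean. -/
lemma measure_abs_hits_sub_ge_le (hV : ∀ i, HasLaw (V i) ν P) (hind : iIndepFun V P) {B : Set F}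
    (hB : MeasurableSet B) (N : ℕ) {δ : ℝ} (hδ : 0 < δ) :
    P {ω | δ ≤ |(hits B (fun i : Fin N => V i ω) : ℝ) - N * ν.real B|} ≤
      ENNReal.ofReal (N * ν.real B / δ ^ 2) := by
  have hI : Measurable (B.indicator fun _ => (1 : ℝ)) := measurable_const.indicator hB
  have hind' : iIndepFun (fun i : Fin N => B.indicator (fun _ => (1 : ℝ)) ∘ V i) P :=
    (hind.precomp Fin.val_injective).comp _ fun _ => hI
  have hsum : (fun ω => (hits B (fun i : Fin N => V i ω) : ℝ)) =
      ∑ i : Fin N, B.indicator (fun _ => (1 : ℝ)) ∘ V i := by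
    ext ω; simp [cast_hits]
  have hL : ∀ i : ℕ, MemLp (B.indicator (fun _ => (1 : ℝ)) ∘ V i) 2 P := fun i =>
    MemLp.of_bound (hI.comp_aemeasurable (hV i).aemeasurable).aestronglyMeasurable 1
      (Eventually.of_forall fun ω => by by_cases h : V i ω ∈ B <;> simp [h])
  have hmean : ∫ ω, (∑ i : Fin N, B.indicator (fun _ => (1 : ℝ)) ∘ V i) ω ∂P = N * ν.real B := by
    simp_rw [Finset.sum_apply, Function.comp_apply]
    rw [integral_finsetSum _ fun (i : Fin N) _ => integrable_indicator_hasLaw (hV i) hB]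
    simp_rw [integral_indicator_hasLaw (hV _) hB]
    simp
  have hvar : variance (∑ i : Fin N, B.indicator (fun _ => (1 : ℝ)) ∘ V i) P ≤
      N * ν.real B := by
    rw [IndepFun.variance_sum (fun (i : Fin N) _ => hL i) fun i _ j _ hij => hind'.indepFun hij]
    refine (Finset.sum_le_sum (g := fun _ => ν.real B) fun i _ => ?_).trans (by simp)
    refine (variance_le_expectation_sq (hL i).aestronglyMeasurable).trans (le_of_eq ?_)
    rw [← integral_indicator_hasLaw (hV i) hB]
    refine integral_congr_ae (Eventually.of_forall fun ω => ?_)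
    by_cases h : V i ω ∈ B <;> simp [h]
  have h := meas_ge_le_variance_div_sq (μ := P)
    (memLp_finsetSum' Finset.univ fun (i : Fin N) _ => hL i) hδ
  rw [hmean, ← hsum] at h
  refine h.trans (ENNReal.ofReal_le_ofReal ?_)
  rw [hsum]
  gcongr

variable [IsProbabilityMeasure ν]

/-- Poisson domination: each factor is `1 + q(eˢ - 1)`, at most `exp (q(eˢ - 1))`. -/
lemma mgf_hits_le (hV : ∀ i, HasLaw (V i) ν P) (hind : iIndepFun V P) {B : Set F}
    (hB : MeasurableSet B) (N : ℕ) (s : ℝ) :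
    mgf (fun ω => (hits B (fun i : Fin N => V i ω) : ℝ)) P s ≤
      Real.exp (N * ν.real B * (Real.exp s - 1)) := by
  have hI : Measurable (B.indicator fun _ => (1 : ℝ)) := measurable_const.indicator hB
  have hind' : iIndepFun (fun i : Fin N => B.indicator (fun _ => (1 : ℝ)) ∘ V i) P :=
    (hind.precomp Fin.val_injective).comp _ fun _ => hI
  have hsum : (fun ω => (hits B (fun i : Fin N => V i ω) : ℝ)) =
      ∑ i : Fin N, B.indicator (fun _ => (1 : ℝ)) ∘ V i := by
    ext ω; simp [cast_hits]
  rw [hsum, hind'.mgf_sum₀ fun i => hI.comp_aemeasurable (hV i).aemeasurable]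
  have hone : ∀ i : Fin N, mgf (B.indicator (fun _ => (1 : ℝ)) ∘ V i) P s =
      1 + ν.real B * (Real.exp s - 1) := by
    intro i
    have : (fun ω => Real.exp (s * (B.indicator (fun _ => (1 : ℝ)) ∘ V i) ω)) =
        fun ω => 1 + B.indicator (fun _ => (1 : ℝ)) (V i ω) * (Real.exp s - 1) := by
      ext ω
      by_cases h : V i ω ∈ B <;> simp [h]
    rw [mgf, this, integral_add (integrable_const _)
      ((integrable_indicator_hasLaw (hV i) hB).mul_const _), integral_mul_const,
      integral_indicator_hasLaw (hV i) hB]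
    simp
  simp_rw [hone]
  rw [Finset.prod_const, Finset.card_univ, Fintype.card_fin, mul_assoc, Real.exp_nat_mul]
  refine pow_le_pow_left₀ ?_ ?_ _
  · nlinarith [measureReal_le_one (μ := ν) (s := B), measureReal_nonneg (μ := ν) (s := B),
      Real.exp_pos s]
  · linarith [Real.add_one_le_exp (ν.real B * (Real.exp s - 1))]

/-- Chernoff's bound with parameter `-1`, using `e⁻¹ - 1 ≤ -1/2`. -/
lemma measure_hits_lt_le (hV : ∀ i, HasLaw (V i) ν P) (hind : iIndepFun V P) {B : Set F}
    (hB : MeasurableSet B) (N k : ℕ) {q : ℝ} (hq : q ≤ ν.real B) :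
    P {ω | hits B (fun i : Fin N => V i ω) < k} ≤
      ENNReal.ofReal (Real.exp (k - N * q / 2)) := by
  have h1 := measure_le_le_exp_mul_mgf (μ := P) (t := -1)
    (X := fun ω => (hits B (fun i : Fin N => V i ω) : ℝ)) (k : ℝ) (by norm_num)
    (integrable_exp_hits hV hB N _)
  have hsub : {ω | hits B (fun i : Fin N => V i ω) < k} ⊆
      {ω | (hits B (fun i : Fin N => V i ω) : ℝ) ≤ k} := fun ω hω => by
    have : hits B (fun i : Fin N => V i ω) < k := hω
    exact_mod_cast this.le
  refine (measure_mono hsub).trans ?_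
  rw [← ofReal_measureReal]
  refine ENNReal.ofReal_le_ofReal (h1.trans ?_)
  refine (mul_le_mul_of_nonneg_left (mgf_hits_le hV hind hB N _) (Real.exp_pos _).le).trans ?_
  rw [← Real.exp_add, Real.exp_le_exp]
  have he : Real.exp (-1) ≤ 1 / 2 := by
    rw [Real.exp_neg, ← one_div]
    have := Real.add_one_le_exp (1 : ℝ)
    exact one_div_le_one_div_of_le (by norm_num) (by linarith)
  have hNq : (N : ℝ) * q ≤ N * ν.real B := by gcongr
  have h0 : 0 ≤ (N : ℝ) * ν.real B := by positivity
  nlinarith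

/-- From `yᵖ ≤ p! eʸ` with `y` the excess over `4l`, and the exponential moment at parameter `1`:
the exponent is at most `-4l + (e - 1)l`, and `e - 1 < 2`. -/
lemma lintegral_hits_excess_le (hV : ∀ i, HasLaw (V i) ν P) (hind : iIndepFun V P) {B : Set F}
    (hB : MeasurableSet B) (N : ℕ) {p : ℕ} (hp : 1 ≤ p) {l : ℝ} (hl : N * ν.real B ≤ l) :
    ∫⁻ ω, ENNReal.ofReal (max ((hits B (fun i : Fin N => V i ω) : ℝ) - 4 * l) 0 ^ p) ∂P ≤
      ENNReal.ofReal (p.factorial * Real.exp (-(2 * l))) := by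
  have hpt : ∀ ω, ENNReal.ofReal
      (max ((hits B (fun i : Fin N => V i ω) : ℝ) - 4 * l) 0 ^ p) ≤
      ENNReal.ofReal (p.factorial * Real.exp (-(4 * l)) *
        Real.exp (1 * (hits B (fun i : Fin N => V i ω) : ℝ))) := by
    intro ω
    refine ENNReal.ofReal_le_ofReal ?_
    rw [mul_assoc, ← Real.exp_add]
    rcases le_total ((hits B (fun i : Fin N => V i ω) : ℝ) - 4 * l) 0 with h | h
    · rw [max_eq_right h, zero_pow (by omega)]
      positivity
    · rw [max_eq_left h]
      have := Real.pow_div_factorial_le_exp _ h p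
      rw [div_le_iff₀ (by positivity)] at this
      rw [mul_comm (p.factorial : ℝ), show -(4 * l) + 1 * (hits B (fun i : Fin N => V i ω) : ℝ) =
        (hits B (fun i : Fin N => V i ω) : ℝ) - 4 * l by ring]
      exact this
  refine (lintegral_mono hpt).trans ?_
  rw [← ofReal_integral_eq_lintegral_ofReal ((integrable_exp_hits hV hB N 1).const_mul _)
    (Eventually.of_forall fun ω => by positivity), integral_const_mul, mul_assoc]
  refine ENNReal.ofReal_le_ofReal (mul_le_mul_of_nonneg_left ?_ (by positivity))
  refine (mul_le_mul_of_nonneg_left (mgf_hits_le hV hind hB N 1) (Real.exp_pos _).le).trans ?_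
  rw [← Real.exp_add, Real.exp_le_exp]
  have h0 : 0 ≤ (N : ℝ) * ν.real B := by positivity
  nlinarith [Real.exp_one_lt_d9]

end Binomial

/-! ### Membership in the catchment area, in terms of counts. -/

section Catchment

variable {d m : ℕ}

lemma mem_catchment_iff {N M : ℕ} (hM : 1 ≤ M) (hMN : M ≤ N) (𝒵 : Set (E d)) (ψ : E d → E m)
    (xs : Fin N → E d) (x z : E d) :
    z ∈ catchment 𝒵 M ψ xs x ↔
      z ∈ 𝒵 ∧ hits (Set.Iio ‖ψ x - ψ z‖) (fun i => ‖ψ (xs i) - ψ z‖) < M := by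
  rw [catchment, Set.mem_ofPred_eq, matchRadius, le_orderStat_iff _ hM hMN]

lemma matchCount_eq_hits {N K : ℕ} (𝒵 : Set (E d)) (M : ℕ) (ψ : E d → E m)
    (xs : Fin N → E d) (zs : Fin K → E d) (x : E d) :
    matchCount 𝒵 M ψ xs zs x = hits (catchment 𝒵 M ψ xs x) zs :=
  (cast_hits _ _).symm

lemma ratioEst_nonneg {N K : ℕ} (𝒵 : Set (E d)) (M : ℕ) (ψ : E d → E m)
    (xs : Fin N → E d) (zs : Fin K → E d) (x : E d) : 0 ≤ ratioEst 𝒵 M ψ xs zs x := by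
  rw [ratioEst, matchCount_eq_hits]
  positivity

lemma measurable_ratioEst {N K M : ℕ} (hM : 1 ≤ M) (hMN : M ≤ N) {𝒵 : Set (E d)}
    (h𝒵 : MeasurableSet 𝒵) {Ψ : (Fin N → E d) × (Fin K → E d) × E d → E m} (hΨ : Measurable Ψ)
    (x : E d) :
    Measurable fun w : (Fin N → E d) × (Fin K → E d) =>
      ratioEst 𝒵 M (fun s => Ψ (w.1, w.2, s)) w.1 w.2 x := by
  have hev : ∀ s : (Fin N → E d) × (Fin K → E d) → E d, Measurable s →
      Measurable fun w : (Fin N → E d) × (Fin K → E d) => Ψ (w.1, w.2, s w) := fun s hs =>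
    hΨ.comp (measurable_fst.prodMk (measurable_snd.prodMk hs))
  have hz : ∀ j, Measurable fun w : (Fin N → E d) × (Fin K → E d) => w.2 j := fun j =>
    (measurable_pi_apply j).comp measurable_snd
  have hset : ∀ j, MeasurableSet {w : (Fin N → E d) × (Fin K → E d) |
      w.2 j ∈ catchment 𝒵 M (fun s => Ψ (w.1, w.2, s)) w.1 x} := by
    intro j
    simp_rw [mem_catchment_iff hM hMN]
    -- The radius of the ray depends on the data. Pairing each distance with that radius turns the
    -- count into hits of the fixed set `y.1 < y.2`.
    have hcast : {w : (Fin N → E d) × (Fin K → E d) |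
        hits (Set.Iio ‖Ψ (w.1, w.2, x) - Ψ (w.1, w.2, w.2 j)‖)
          (fun i => ‖Ψ (w.1, w.2, w.1 i) - Ψ (w.1, w.2, w.2 j)‖) < M} =
        {w | (hits {y : ℝ × ℝ | y.1 < y.2} (fun i =>
          (‖Ψ (w.1, w.2, w.1 i) - Ψ (w.1, w.2, w.2 j)‖,
            ‖Ψ (w.1, w.2, x) - Ψ (w.1, w.2, w.2 j)‖)) : ℝ) < M} := by
      ext w
      simp only [Set.mem_ofPred_eq, Nat.cast_lt]
      rfl
    refine (hz j h𝒵).inter (MeasurableSet.congr ?_ hcast.symm)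
    refine measurableSet_lt (measurable_hits (measurableSet_lt measurable_fst measurable_snd)
      (measurable_pi_lambda _ fun i => ?_)) measurable_const
    exact (((hev _ ((measurable_pi_apply i).comp measurable_fst)).sub (hev _ (hz j))).norm).prodMk
      (((hev _ measurable_const).sub (hev _ (hz j))).norm)
  unfold ratioEst
  refine ((?_ : Measurable _).div_const _).const_mul _
  unfold matchCount
  refine Finset.measurable_sum _ fun j _ => ?_
  exact (measurable_const (a := (1 : ℝ))).indicator (hset j)

/-- The increments of `ψ - φ` over `𝒳` are at most `ε` times those of `φ`, down to scale `u`. -/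
def IncrementBound (𝒳 : Set (E d)) (φ ψ : E d → E m) (ε u : ℝ) : Prop :=
  ∀ s ∈ 𝒳, ∀ t ∈ 𝒳, ‖(ψ s - φ s) - (ψ t - φ t)‖ ≤ ε * max u ‖φ s - φ t‖

lemma IncrementBound.mono {𝒳 : Set (E d)} {φ ψ : E d → E m} {ε u v : ℝ} (hε : 0 ≤ ε)
    (h : IncrementBound 𝒳 φ ψ ε u) (huv : u ≤ v) : IncrementBound 𝒳 φ ψ ε v := fun s hs t ht =>
  (h s hs t ht).trans (by gcongr)

lemma IncrementBound.norm_le {𝒳 : Set (E d)} {φ ψ : E d → E m} {ε u : ℝ}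
    (h : IncrementBound 𝒳 φ ψ ε u) {s t : E d} (hs : s ∈ 𝒳) (ht : t ∈ 𝒳) :
    ‖ψ s - ψ t‖ ≤ ‖φ s - φ t‖ + ε * max u ‖φ s - φ t‖ := by
  have h1 := h s hs t ht
  have h2 : ψ s - ψ t = (φ s - φ t) + ((ψ s - φ s) - (ψ t - φ t)) := by abel
  rw [h2]
  exact (norm_add_le _ _).trans (by linarith)

lemma IncrementBound.le_norm {𝒳 : Set (E d)} {φ ψ : E d → E m} {ε u : ℝ}
    (h : IncrementBound 𝒳 φ ψ ε u) {s t : E d} (hs : s ∈ 𝒳) (ht : t ∈ 𝒳) :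
    ‖φ s - φ t‖ - ε * max u ‖φ s - φ t‖ ≤ ‖ψ s - ψ t‖ := by
  have h1 := h s hs t ht
  have h2 : φ s - φ t = (ψ s - ψ t) - ((ψ s - φ s) - (ψ t - φ t)) := by abel
  have h3 := norm_sub_le (ψ s - ψ t) ((ψ s - φ s) - (ψ t - φ t))
  rw [← h2] at h3
  linarith

variable {𝒳 𝒵 : Set (E d)} {φ ψ : E d → E m} {ε u b : ℝ} {N M : ℕ} {xs : Fin N → E d} {x z : E d}

/-- Every `xs i` whose image lies in the `b`-ball beats `x` as a neighbour of `z` even after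
estimation: the margin in `hb` pays for one increment error on each of the two distances. -/
lemma IncrementBound.notMem_catchment (h : IncrementBound 𝒳 φ ψ ε u) (hε : 0 ≤ ε)
    (hM : 1 ≤ M) (hMN : M ≤ N) (hx : x ∈ 𝒳) (hz : z ∈ 𝒳) (hxs : ∀ i, xs i ∈ 𝒳)
    (hb : b + 2 * (ε * max u ‖φ x - φ z‖) ≤ ‖φ x - φ z‖) (hu : 0 ≤ u)
    (hhits : M ≤ hits (Metric.ball (φ z) b) fun i => φ (xs i)) :
    z ∉ catchment 𝒵 M ψ xs x := by
  rw [mem_catchment_iff hM hMN, not_and, not_lt]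
  refine fun _ => hhits.trans (hits_le_hits fun i hi => ?_)
  rw [Metric.mem_ball, dist_eq_norm] at hi
  have h1 := h.norm_le (hxs i) hz
  have h2 := h.le_norm hx hz
  have h0 : 0 ≤ ε * max u ‖φ x - φ z‖ := mul_nonneg hε (le_max_of_le_left hu)
  have h3 : ε * max u ‖φ (xs i) - φ z‖ ≤ ε * max u ‖φ x - φ z‖ := by
    gcongr
    linarith
  rw [Set.mem_Iio]
  linarith

/-- Conversely, only points with image in the `b`-ball can beat `x`, because a point outside stays
too far after estimation. -/
lemma IncrementBound.mem_catchment (h : IncrementBound 𝒳 φ ψ ε u) (hε : 0 ≤ ε) (hε1 : ε ≤ 1)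
    (hM : 1 ≤ M) (hMN : M ≤ N) (hx : x ∈ 𝒳) (hz : z ∈ 𝒳) (hz' : z ∈ 𝒵) (hxs : ∀ i, xs i ∈ 𝒳)
    (hb : ‖φ x - φ z‖ + 2 * (ε * max u b) ≤ b) (hu : 0 ≤ u)
    (hhits : hits (Metric.ball (φ z) b) (fun i => φ (xs i)) < M) :
    z ∈ catchment 𝒵 M ψ xs x := by
  rw [mem_catchment_iff hM hMN]
  refine ⟨hz', (hits_le_hits fun i hi => ?_).trans_lt hhits⟩
  rw [Metric.mem_ball, dist_eq_norm]
  rw [Set.mem_Iio] at hi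
  by_contra hcon
  rw [not_lt] at hcon
  have h1 := h.le_norm (hxs i) hz
  have h2 := h.norm_le hx hz
  have h0 : 0 ≤ ε * max u b := mul_nonneg hε (le_max_of_le_left hu)
  have h3 : ε * max u ‖φ x - φ z‖ ≤ ε * max u b := by
    gcongr
    linarith
  -- The permitted error grows with slope at most `ε ≤ 1` in the distance, so the worst case outside
  -- the ball is at distance `b`.
  have h4 : max u ‖φ (xs i) - φ z‖ ≤ max u b + (‖φ (xs i) - φ z‖ - b) := by
    refine max_le ?_ ?_
    · linarith [le_max_left u b]
    · linarith [le_max_right u b]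
  have h5 := mul_le_mul_of_nonneg_left h4 hε
  nlinarith

/-- A uniform error `ε` perturbs each of the two distances by at most `2ε`. This version handles
points beyond the largest dyadic scale. -/
lemma notMem_catchment_of_norm_le (h : ∀ s ∈ 𝒳, ‖ψ s - φ s‖ ≤ ε)
    (hM : 1 ≤ M) (hMN : M ≤ N) (hx : x ∈ 𝒳) (hz : z ∈ 𝒳) (hxs : ∀ i, xs i ∈ 𝒳)
    (hb : b + 4 * ε ≤ ‖φ x - φ z‖)
    (hhits : M ≤ hits (Metric.ball (φ z) b) fun i => φ (xs i)) :
    z ∉ catchment 𝒵 M ψ xs x := by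
  rw [mem_catchment_iff hM hMN, not_and, not_lt]
  refine fun _ => hhits.trans (hits_le_hits fun i hi => ?_)
  rw [Metric.mem_ball, dist_eq_norm] at hi
  have h1 : ψ (xs i) - ψ z = (φ (xs i) - φ z) + ((ψ (xs i) - φ (xs i)) - (ψ z - φ z)) := by abel
  have h2 : φ x - φ z = (ψ x - ψ z) - ((ψ x - φ x) - (ψ z - φ z)) := by abel
  have h3 := norm_add_le (φ (xs i) - φ z) ((ψ (xs i) - φ (xs i)) - (ψ z - φ z))
  have h4 := norm_sub_le (ψ x - ψ z) ((ψ x - φ x) - (ψ z - φ z))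
  rw [← h1] at h3
  rw [← h2] at h4
  have h5 := norm_sub_le (ψ (xs i) - φ (xs i)) (ψ z - φ z)
  have h6 := norm_sub_le (ψ x - φ x) (ψ z - φ z)
  rw [Set.mem_Iio]
  linarith [h x hx, h z hz, h _ (hxs i)]

end Catchment

/-! ### Finite nets in Euclidean balls. -/

section Net

variable {m : ℕ}

lemma exists_finset_net (m : ℕ) (R : ℝ) {δ : ℝ} (hδ : 0 < δ) :
    ∃ S : Finset (E m), (∀ s ∈ S, ‖s‖ ≤ R) ∧ ∀ y : E m, ‖y‖ ≤ R → ∃ s ∈ S, ‖y - s‖ < δ := by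
  obtain ⟨t, hts, htf, hcov⟩ := (isCompact_closedBall (0 : E m) R).finite_cover_balls hδ
  refine ⟨htf.toFinset, fun s hs => ?_, fun y hy => ?_⟩
  · simpa using hts (htf.mem_toFinset.1 hs)
  · have := hcov (show y ∈ Metric.closedBall (0 : E m) R by simpa using hy)
    simp only [Set.mem_iUnion, Metric.mem_ball, dist_eq_norm] at this
    obtain ⟨s, hs, h⟩ := this
    exact ⟨s, htf.mem_toFinset.2 hs, h⟩

/-- Take `s` within `1/8` of half the unit vector from `c` towards `w`. The centre `c + t • s` is
then closer to `w` than `c` is by at least `t/2 - t/8`, and the radius `t/4` leaves a gain of `t/8`.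
Finitely many balls thus serve every far point `w`. -/
lemma exists_ball_subset_of_net {S : Finset (E m)}
    (hS : ∀ y : E m, ‖y‖ ≤ 1 → ∃ s ∈ S, ‖y - s‖ < 1 / 8) {c w : E m} {t : ℝ} (ht : 0 < t)
    (hw : t ≤ ‖w - c‖) :
    ∃ s ∈ S, Metric.ball (c + t • s) (t / 4) ⊆ Metric.ball w (‖w - c‖ - t / 8) := by
  have hr : 0 < ‖w - c‖ := ht.trans_le hw
  obtain ⟨s, hs, hys⟩ := hS ((1 / (2 * ‖w - c‖)) • (w - c)) (by
    rw [norm_smul, Real.norm_of_nonneg (by positivity)]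
    field_simp
    norm_num)
  refine ⟨s, hs, Metric.ball_subset_ball' ?_⟩
  have h1 : c + t • s - w = (t / (2 * ‖w - c‖) - 1) • (w - c) +
      t • (s - (1 / (2 * ‖w - c‖)) • (w - c)) := by
    module
  have h2 : ‖(t / (2 * ‖w - c‖) - 1) • (w - c)‖ = ‖w - c‖ - t / 2 := by
    have : t / (2 * ‖w - c‖) ≤ 1 := by
      rw [div_le_one (by positivity)]
      linarith
    rw [norm_smul, Real.norm_of_nonpos (by linarith)]
    field_simp
    ring
  have h3 : ‖t • (s - (1 / (2 * ‖w - c‖)) • (w - c))‖ ≤ t * (1 / 8) := by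
    rw [norm_smul, Real.norm_of_nonneg ht.le, norm_sub_rev]
    gcongr
  have h4 := norm_add_le ((t / (2 * ‖w - c‖) - 1) • (w - c))
    (t • (s - (1 / (2 * ‖w - c‖)) • (w - c)))
  rw [dist_eq_norm, h1]
  linarith

end Net

/-! ### Mass of small balls near a continuity point of the density. -/

section Density

variable {m : ℕ}

lemma volume_real_ball (y : E m) {ρ : ℝ} (hρ : 0 < ρ) :
    volume.real (Metric.ball y ρ) = volume.real (Metric.ball (0 : E m) 1) * ρ ^ m := by
  rw [measureReal_def, Measure.addHaar_ball_of_pos _ _ hρ, ENNReal.toReal_mul,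
    ENNReal.toReal_ofReal (by positivity), mul_comm, measureReal_def]
  simp

lemma volume_real_unit_ball_pos (m : ℕ) : 0 < volume.real (Metric.ball (0 : E m) 1) :=
  ENNReal.toReal_pos (Metric.measure_ball_pos _ _ one_pos).ne' measure_ball_lt_top.ne

lemma exists_measureReal_ball_bounds {ν : Measure (E m)} {f : E m → ℝ≥0}
    (hν : ν = volume.withDensity fun u => (f u : ℝ≥0∞)) {c : E m} (hc : ContinuousAt f c)
    {δ : ℝ} (hδ : 0 < δ) :
    ∃ r > 0, ∀ (y : E m) (ρ : ℝ), 0 < ρ → Metric.ball y ρ ⊆ Metric.ball c r →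
      (f c - δ) * (volume.real (Metric.ball (0 : E m) 1) * ρ ^ m) ≤ ν.real (Metric.ball y ρ) ∧
      ν.real (Metric.ball y ρ) ≤ (f c + δ) * (volume.real (Metric.ball (0 : E m) 1) * ρ ^ m) := by
  obtain ⟨r, hr, hball⟩ := Metric.continuousAt_iff.1 hc δ hδ
  refine ⟨r, hr, fun y ρ hρ hsub => ?_⟩
  have hf : ∀ u ∈ Metric.ball y ρ, |(f u : ℝ) - f c| < δ := fun u hu => by
    have := hball (hsub hu)
    rwa [NNReal.dist_eq] at this
  have hval : ν (Metric.ball y ρ) = ∫⁻ u in Metric.ball y ρ, (f u : ℝ≥0∞) := by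
    rw [hν, withDensity_apply _ measurableSet_ball]
  have hup : ν (Metric.ball y ρ) ≤
      ENNReal.ofReal (f c + δ) * volume (Metric.ball y ρ) := by
    rw [hval, ← setLIntegral_const]
    refine setLIntegral_mono' measurableSet_ball fun u hu => ?_
    rw [← ENNReal.ofReal_coe_nnreal]
    exact ENNReal.ofReal_le_ofReal (by linarith [(abs_lt.1 (hf u hu)).2])
  have hlo : ENNReal.ofReal (f c - δ) * volume (Metric.ball y ρ) ≤ ν (Metric.ball y ρ) := by
    rw [hval, ← setLIntegral_const]
    refine setLIntegral_mono' measurableSet_ball fun u hu => ?_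
    rw [← ENNReal.ofReal_coe_nnreal]
    exact ENNReal.ofReal_le_ofReal (by linarith [(abs_lt.1 (hf u hu)).1])
  have hfin : ENNReal.ofReal (f c + δ) * volume (Metric.ball y ρ) ≠ ∞ :=
    ENNReal.mul_ne_top ENNReal.ofReal_ne_top measure_ball_lt_top.ne
  rw [← volume_real_ball y hρ]
  constructor
  -- `ENNReal.ofReal` truncates a negative lower constant to zero, so that case is separate; there
  -- the bound is trivial.
  · rcases le_total ((f c : ℝ) - δ) 0 with h | h
    · exact (mul_nonpos_of_nonpos_of_nonneg h measureReal_nonneg).trans measureReal_nonneg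
    · have := ENNReal.toReal_mono (ne_top_of_le_ne_top hfin hup) hlo
      rwa [ENNReal.toReal_mul, ENNReal.toReal_ofReal h] at this
  · have := ENNReal.toReal_mono hfin hup
    rwa [ENNReal.toReal_mul, ENNReal.toReal_ofReal (by positivity)] at this

end Density

/-! ### Exponential sums over dyadic scales. -/

section DyadicSums

lemma pow_mul_exp_neg_le {x : ℝ} (hx : 0 < x) (p : ℕ) :
    x ^ p * Real.exp (-x) ≤ (p + 1).factorial / x := by
  have := Real.pow_div_factorial_le_exp _ hx.le (p + 1)
  rw [div_le_iff₀ (by positivity)] at this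
  rw [Real.exp_neg, ← div_eq_mul_inv, div_le_div_iff₀ (Real.exp_pos _) hx, ← pow_succ]
  linarith

lemma two_pow_le_two_pow_mul (i : ℕ) {m : ℕ} (hm : 1 ≤ m) : (2 : ℝ) ^ i ≤ 2 ^ (i * m) :=
  pow_le_pow_right₀ (by norm_num) (Nat.le_mul_of_pos_right i hm)

/-- One spare power in `xᵖ⁺¹ ≤ (p+1)! eˣ` leaves a factor `1/x`, hence a geometric series. The bound
does not depend on the number of scales. -/
lemma sum_pow_mul_exp_neg_le {a : ℝ} (ha : 0 < a) {m : ℕ} (hm : 1 ≤ m) (p I : ℕ) :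
    ∑ i ∈ Finset.range I, (a * 2 ^ (i * m)) ^ p * Real.exp (-(a * 2 ^ (i * m))) ≤
      2 * (p + 1).factorial / a := by
  calc ∑ i ∈ Finset.range I, (a * 2 ^ (i * m)) ^ p * Real.exp (-(a * 2 ^ (i * m)))
      ≤ ∑ i ∈ Finset.range I, (p + 1).factorial / a * (1 / (2 : ℝ)) ^ i := by
        refine Finset.sum_le_sum fun i _ => (pow_mul_exp_neg_le (by positivity) p).trans ?_
        rw [one_div, inv_pow, ← div_eq_mul_inv, div_div]
        exact div_le_div_of_nonneg_left (by positivity) (by positivity)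
          (mul_le_mul_of_nonneg_left (two_pow_le_two_pow_mul i hm) ha.le)
    _ ≤ (p + 1).factorial / a * 2 := by
        rw [← Finset.mul_sum]
        gcongr
        exact sum_geometric_two_le I
    _ = 2 * (p + 1).factorial / a := by ring

end DyadicSums

/-! ### Deterministic localization of the catchment area. -/

section Localization

variable {d m : ℕ} {𝒳 𝒵 : Set (E d)} {φ ψ : E d → E m} {ε δ t : ℝ} {N M : ℕ}
  {xs : Fin N → E d} {x z : E d}

lemma exists_dyadic_scale {t r : ℝ} (ht : 0 < t) {i I : ℕ} (hi : 2 ^ i * t ≤ r)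
    (hI : r < 2 ^ I * t) : ∃ k, i ≤ k ∧ k < I ∧ 2 ^ k * t ≤ r ∧ r < 2 ^ (k + 1) * t := by
  induction I with
  | zero =>
    have : (1 : ℝ) ≤ 2 ^ i := one_le_pow₀ (by norm_num)
    nlinarith
  | succ I ih =>
    rcases lt_or_ge r (2 ^ I * t) with h | h
    · obtain ⟨k, h1, h2, h3⟩ := ih h
      exact ⟨k, h1, by omega, h3⟩
    · refine ⟨I, ?_, by omega, h, hI⟩
      have h1 : (2 : ℝ) ^ i < 2 ^ (I + 1) := lt_of_mul_lt_mul_right (hi.trans_lt hI) ht.le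
      have := (pow_lt_pow_iff_right₀ (by norm_num : (1 : ℝ) < 2)).1 h1
      omega

/-- A matched `z` outside the ball would have distance in some dyadic shell `k ≥ i`, or beyond the
top scale. In either case a net ball with at least `M` points lies between `φ x` and `φ z`, so `z`
has too many closer neighbours. Control of increments at scale `2ⁱ t` covers all the larger shells.
-/
lemma norm_lt_of_mem_catchment {S : Finset (E m)}
    (hS : ∀ y : E m, ‖y‖ ≤ 1 → ∃ s ∈ S, ‖y - s‖ < 1 / 8) (ht : 0 < t) {i I : ℕ} (hiI : i ≤ I)
    (hε : 0 ≤ ε) (hε' : ε ≤ 1 / 32) (hinc : IncrementBound 𝒳 φ ψ ε (2 ^ i * t))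
    (hball : ∀ k, i ≤ k → k ≤ I → ∀ s ∈ S,
      M ≤ hits (Metric.ball (φ x + (2 ^ k * t) • s) (2 ^ k * t / 4)) fun i => φ (xs i))
    (hδ : δ ≤ 2 ^ I * t / 32) (hsup : ∀ s ∈ 𝒳, ‖ψ s - φ s‖ ≤ δ)
    (hM : 1 ≤ M) (hMN : M ≤ N) (hx : x ∈ 𝒳) (hz : z ∈ 𝒳) (hxs : ∀ i, xs i ∈ 𝒳)
    (hzA : z ∈ catchment 𝒵 M ψ xs x) : φ z ∈ Metric.ball (φ x) (2 ^ i * t) := by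
  rw [Metric.mem_ball, dist_eq_norm]
  by_contra hcon
  rw [not_lt] at hcon
  have key : ∀ k, i ≤ k → k ≤ I → 2 ^ k * t ≤ ‖φ z - φ x‖ →
      M ≤ hits (Metric.ball (φ z) (‖φ x - φ z‖ - 2 ^ k * t / 8)) fun i => φ (xs i) := by
    intro k hk hkI hle
    obtain ⟨s, hs, hsub⟩ := exists_ball_subset_of_net hS (by positivity) hle
    rw [norm_sub_rev (φ x)]
    exact (hball k hk hkI s hs).trans (hits_le_hits fun j hj => hsub hj)
  rcases le_or_gt (2 ^ I * t) ‖φ z - φ x‖ with h | h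
  · refine notMem_catchment_of_norm_le hsup hM hMN hx hz hxs ?_ (key I hiI le_rfl h) hzA
    linarith
  -- In shell `k` the distance is below `2 · 2ᵏ t`, so `2ε` times it is at most the gain `2ᵏ t / 8`:
  -- this fixes the constant `1/32`.
  · obtain ⟨k, hik, hkI, hk1, hk2⟩ := exists_dyadic_scale ht hcon h
    refine hinc.notMem_catchment hε hM hMN hx hz hxs ?_ (by positivity)
      (key k hik hkI.le hk1) hzA
    rw [norm_sub_rev (φ x), max_eq_right hcon]
    rw [pow_succ] at hk2
    have h0 : 0 ≤ ‖φ z - φ x‖ := norm_nonneg _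
    nlinarith

end Localization

/-! ### Splitting the power of the count over scales. -/

lemma pow_le_two_pow_mul_of_le_add_max {κ a b : ℝ} (hκ : 0 ≤ κ) (ha : 0 ≤ a) (h : κ ≤ b) (p : ℕ) :
    κ ^ p ≤ 2 ^ p * (a ^ p + max (b - a) 0 ^ p) := by
  have h1 : κ ≤ a + max (b - a) 0 := by linarith [le_max_left (b - a) 0]
  calc κ ^ p ≤ (a + max (b - a) 0) ^ p := by gcongr
    _ ≤ 2 ^ (p - 1) * (a ^ p + max (b - a) 0 ^ p) := add_pow_le ha (le_max_right _ _) p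
    _ ≤ 2 ^ p * (a ^ p + max (b - a) 0 ^ p) := by
        gcongr
        · norm_num
        · omega

/-- Let `j` be the last bad scale. Localization at `j + 1` bounds `κ` by `l (j + 1)` plus an excess,
and the indicator of `A j` pays for `l (j + 1)`. If no scale is bad, localize at `0`; if `j = I`,
use `htop`. -/
lemma pow_le_of_dyadic_localization {κ : ℝ} (hκ : 0 ≤ κ) {cnt l : ℕ → ℝ} (hl : ∀ i, 0 ≤ l i)
    {A : ℕ → Prop} [DecidablePred A] {I : ℕ} (hloc : ∀ i ≤ I, (∀ k, i ≤ k → k ≤ I → ¬ A k) → κ ≤ cnt i)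
    (htop : κ ≤ l (I + 1)) (p : ℕ) :
    κ ^ p ≤ 2 ^ p * (l 0 ^ p + (∑ i ∈ Finset.range (I + 1), max (cnt i - l i) 0 ^ p +
      ∑ i ∈ Finset.range (I + 1), if A i then l (i + 1) ^ p else 0)) := by
  have hexc : ∀ i ∈ Finset.range (I + 1), 0 ≤ max (cnt i - l i) 0 ^ p := fun i _ =>
    pow_nonneg (le_max_right _ _) _
  have hind : ∀ i ∈ Finset.range (I + 1), 0 ≤ if A i then l (i + 1) ^ p else 0 := fun i _ => by
    split_ifs
    · exact pow_nonneg (hl _) _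
    · exact le_rfl
  have hE := Finset.sum_nonneg hexc
  have hD := Finset.sum_nonneg hind
  have h0 : 0 ≤ l 0 ^ p := pow_nonneg (hl 0) p
  by_cases hno : ∀ k ≤ I, ¬ A k
  · refine (pow_le_two_pow_mul_of_le_add_max hκ (hl 0)
      (hloc 0 (Nat.zero_le _) fun k _ => hno k) p).trans ?_
    have := Finset.single_le_sum hexc (Finset.mem_range.2 (Nat.succ_pos I))
    gcongr
    linarith
  · push Not at hno
    obtain ⟨k, hkI, hk⟩ := hno
    set j := Nat.findGreatest A I with hj
    have hjI : j ≤ I := Nat.findGreatest_le I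
    have hAj : A j := Nat.findGreatest_spec hkI hk
    have hgt : ∀ k, j < k → k ≤ I → ¬ A k := fun k => Nat.findGreatest_is_greatest
    have hjD := Finset.single_le_sum hind (Finset.mem_range.2 (Nat.lt_succ_of_le hjI))
    rw [if_pos hAj] at hjD
    rcases hjI.eq_or_lt with h | h
    · rw [h] at hjD
      calc κ ^ p ≤ 1 * l (I + 1) ^ p := by
            rw [one_mul]
            gcongr
        _ ≤ _ := by
            have : (1 : ℝ) ≤ 2 ^ p := one_le_pow₀ (by norm_num)
            have := pow_nonneg (hl (I + 1)) p
            gcongr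
            linarith
    · refine (pow_le_two_pow_mul_of_le_add_max hκ (hl (j + 1))
        (hloc (j + 1) h fun k h1 => hgt k h1) p).trans ?_
      have := Finset.single_le_sum hexc (Finset.mem_range.2 (Nat.succ_lt_succ h))
      refine mul_le_mul_of_nonneg_left ?_ (by positivity)
      rw [Nat.succ_eq_add_one] at this
      linarith

/-! ### A dominating variable at fixed sample size. -/

section Domination

variable {Ω : Type*} [MeasurableSpace Ω] {P : Measure Ω} [IsProbabilityMeasure P] {d m : ℕ}

/-- Union bound and Chernoff: the mean count in each ball is at least `4 M 2^(im)`, so the exponent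
is at most `M - 2 M 2^(im)`. -/
lemma measure_exists_hits_lt_le {Y : ℕ → Ω → E m} {ν₀ : Measure (E m)} [IsProbabilityMeasure ν₀]
    (hY : ∀ i, HasLaw (Y i) ν₀ P) (hindY : iIndepFun Y P) {n M : ℕ} {S : Finset (E m)} {c : E m}
    {t c₀ : ℝ} {i : ℕ}
    (hν₀ : ∀ s ∈ S, c₀ * (2 ^ i * t) ^ m ≤
      ν₀.real (Metric.ball (c + (2 ^ i * t) • s) (2 ^ i * t / 4)))
    (hct : 4 * M ≤ n * (c₀ * t ^ m)) :
    P {ω | ∃ s ∈ S, hits (Metric.ball (c + (2 ^ i * t) • s) (2 ^ i * t / 4))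
      (fun j : Fin n => Y j ω) < M} ≤
    S.card * ENNReal.ofReal (Real.exp (-(M * 2 ^ (i * m)))) := by
  have hset : {ω | ∃ s ∈ S, hits (Metric.ball (c + (2 ^ i * t) • s) (2 ^ i * t / 4))
      (fun j : Fin n => Y j ω) < M} =
      ⋃ s ∈ S, {ω | hits (Metric.ball (c + (2 ^ i * t) • s) (2 ^ i * t / 4))
        (fun j : Fin n => Y j ω) < M} := by
    ext ω; simp
  rw [hset]
  refine (measure_biUnion_finset_le _ _).trans ?_
  rw [← nsmul_eq_mul]
  refine Finset.sum_le_card_nsmul _ _ _ fun s hs => ?_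
  refine (measure_hits_lt_le hY hindY measurableSet_ball n M (hν₀ s hs)).trans ?_
  refine ENNReal.ofReal_le_ofReal (Real.exp_le_exp.2 ?_)
  have h1 : (1 : ℝ) ≤ 2 ^ (i * m) := one_le_pow₀ (by norm_num)
  have h2 : (n : ℝ) * (c₀ * (2 ^ i * t) ^ m) = 2 ^ (i * m) * (n * (c₀ * t ^ m)) := by
    rw [mul_pow, ← pow_mul]; ring
  rw [h2]
  have h3 : (M : ℝ) ≤ M * 2 ^ (i * m) := le_mul_of_one_le_right (Nat.cast_nonneg _) h1
  have h4 := mul_le_mul_of_nonneg_left hct (by positivity : (0 : ℝ) ≤ 2 ^ (i * m))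
  linarith

/-- Apply the dyadic splitting with `l i` four times the upper bound on the expected count at scale
`i`. The three terms of the bound come from binomial excesses, from bad scales, and from a large
uniform error, where the count is only bounded by `K`. -/
lemma exists_dominating_ratioEst {𝒳 𝒵 : Set (E d)} {φ : E d → E m}
    {X Z : ℕ → Ω → E d} {ν₀ ν₁ : Measure (E m)} [IsProbabilityMeasure ν₀] [IsProbabilityMeasure ν₁]
    (hY : ∀ i, HasLaw (φ ∘ X i) ν₀ P) (hindY : iIndepFun (fun i => φ ∘ X i) P)
    (hW : ∀ i, HasLaw (φ ∘ Z i) ν₁ P) (hindW : iIndepFun (fun i => φ ∘ Z i) P)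
    (hX𝒳 : ∀ᵐ ω ∂P, ∀ i, X i ω ∈ 𝒳) (hZ𝒳 : ∀ᵐ ω ∂P, ∀ j, Z j ω ∈ 𝒳)
    {x : E d} (hx : x ∈ 𝒳) (ψ : Ω → E d → E m) {n K M p : ℕ} (hM : 1 ≤ M) (hMn : M ≤ n)
    (hK : 1 ≤ K) (hp : 1 ≤ p) {S : Finset (E m)}
    (hS : ∀ y : E m, ‖y‖ ≤ 1 → ∃ s ∈ S, ‖y - s‖ < 1 / 8) {t : ℝ} (ht : 0 < t) {I : ℕ}
    {c₀ C : ℝ} (hC : 0 < C)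
    (hν₀ : ∀ i ≤ I, ∀ s ∈ S, c₀ * (2 ^ i * t) ^ m ≤
      ν₀.real (Metric.ball (φ x + (2 ^ i * t) • s) (2 ^ i * t / 4)))
    (hν₁ : ∀ i ≤ I, ν₁.real (Metric.ball (φ x) (2 ^ i * t)) ≤ C * (2 ^ i * t) ^ m)
    (hCtop : 1 ≤ 4 * C * (2 ^ (I + 1) * t) ^ m) (hct : 4 * M ≤ n * (c₀ * t ^ m))
    {ε δ : ℝ} (hε : 0 ≤ ε) (hε' : ε ≤ 1 / 32) (hδ : δ ≤ 2 ^ I * t / 32) :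
    ∃ Y : Ω → ℝ≥0∞, AEMeasurable Y P ∧
      (∀ᵐ ω ∂P, ENNReal.ofReal (ratioEst 𝒵 M (ψ ω) (fun i : Fin n => X i ω)
        (fun j : Fin K => Z j ω) x ^ p) ≤
          ENNReal.ofReal ((8 * C * ((n : ℝ) / M * t ^ m)) ^ p) + Y ω) ∧
      ∫⁻ ω, Y ω ∂P ≤
        ENNReal.ofReal ((2 * ((n : ℝ) / (K * M))) ^ p) * ∑ i ∈ Finset.range (I + 1),
          ENNReal.ofReal (p.factorial * Real.exp (-(2 * (K * (C * (2 ^ i * t) ^ m))))) +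
        ENNReal.ofReal ((8 * C * 2 ^ m) ^ p) * ∑ i ∈ Finset.range (I + 1),
          ENNReal.ofReal (((n : ℝ) / M * (2 ^ i * t) ^ m) ^ p) *
            (P {ω | ¬ IncrementBound 𝒳 φ (ψ ω) ε (2 ^ i * t)} +
              S.card * ENNReal.ofReal (Real.exp (-(M * 2 ^ (i * m))))) +
        ENNReal.ofReal (((n : ℝ) / M) ^ p) *
          P {ω | ¬ ∀ s ∈ 𝒳, ‖ψ ω s - φ s‖ ≤ δ} := by
  classical
  set A : ℕ → Ω → Prop := fun i ω => ¬ IncrementBound 𝒳 φ (ψ ω) ε (2 ^ i * t) ∨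
    ∃ s ∈ S, hits (Metric.ball (φ x + (2 ^ i * t) • s) (2 ^ i * t / 4))
      (fun j : Fin n => (φ ∘ X j) ω) < M with hA
  -- These events quantify over all points of `𝒳` and need not be measurable. Measurable hulls have
  -- the same measure and make the dominating function measurable.
  set A' : ℕ → Set Ω := fun i => toMeasurable P {ω | A i ω} with hA'
  set B' : Set Ω := toMeasurable P {ω | ¬ ∀ s ∈ 𝒳, ‖ψ ω s - φ s‖ ≤ δ} with hB'
  set l : ℕ → ℝ := fun i => 4 * (K * (C * (2 ^ i * t) ^ m)) with hl
  set cnt : ℕ → Ω → ℝ := fun i ω =>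
    (hits (Metric.ball (φ x) (2 ^ i * t)) (fun j : Fin K => (φ ∘ Z j) ω) : ℝ) with hcnt
  set a : ℝ := (n : ℝ) / (K * M) with ha
  have hM0 : (0 : ℝ) < M := by exact_mod_cast hM
  have hK0 : (0 : ℝ) < K := by exact_mod_cast hK
  have hl0 : ∀ i, 0 ≤ l i := fun i => by positivity
  have haK : a * K = (n : ℝ) / M := by rw [ha]; field_simp
  have ha0 : 0 ≤ a := by positivity
  have hcm : ∀ i, AEMeasurable (cnt i) P := fun i =>
    aemeasurable_hits (V := fun j => φ ∘ Z j) (fun i => (hW i).aemeasurable) measurableSet_ball K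
  have hem : ∀ i, AEMeasurable (fun ω => ENNReal.ofReal (max (cnt i ω - l i) 0 ^ p)) P :=
    fun i => ((((hcm i).sub_const _).max aemeasurable_const).pow_const p).ennreal_ofReal
  have him : ∀ i, AEMeasurable (fun ω => ENNReal.ofReal (l (i + 1) ^ p) *
      (A' i).indicator (fun _ => (1 : ℝ≥0∞)) ω) P := fun i =>
    ((measurable_const.indicator (measurableSet_toMeasurable _ _)).const_mul _).aemeasurable
  have hsm : AEMeasurable (fun ω => ENNReal.ofReal ((2 * a) ^ p) * (∑ i ∈ Finset.range (I + 1),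
        ENNReal.ofReal (max (cnt i ω - l i) 0 ^ p) + ∑ i ∈ Finset.range (I + 1),
          ENNReal.ofReal (l (i + 1) ^ p) * (A' i).indicator (fun _ => (1 : ℝ≥0∞)) ω)) P :=
    ((Finset.aemeasurable_fun_sum _ fun i _ => hem i).add
      (Finset.aemeasurable_fun_sum _ fun i _ => him i)).const_mul _
  have hbm : Measurable fun ω => ENNReal.ofReal (((n : ℝ) / M) ^ p) *
      B'.indicator (fun _ => (1 : ℝ≥0∞)) ω :=
    (measurable_const.indicator (measurableSet_toMeasurable _ _)).const_mul _
  refine ⟨fun ω => ENNReal.ofReal ((2 * a) ^ p) * (∑ i ∈ Finset.range (I + 1),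
        ENNReal.ofReal (max (cnt i ω - l i) 0 ^ p) + ∑ i ∈ Finset.range (I + 1),
          ENNReal.ofReal (l (i + 1) ^ p) * (A' i).indicator (fun _ => (1 : ℝ≥0∞)) ω) +
      ENNReal.ofReal (((n : ℝ) / M) ^ p) * B'.indicator (fun _ => (1 : ℝ≥0∞)) ω,
    hsm.add hbm.aemeasurable, ?_, ?_⟩
  · filter_upwards [hX𝒳, hZ𝒳] with ω hXω hZω
    rw [ratioEst, matchCount_eq_hits]
    set κ : ℕ := hits (catchment 𝒵 M (ψ ω) (fun i : Fin n => X i ω) x)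
      (fun j : Fin K => Z j ω) with hκ
    have hκK : (κ : ℝ) ≤ K := by exact_mod_cast hits_le _ _
    have hR : (n : ℝ) / K * (κ / M) = a * κ := by rw [ha]; field_simp
    rw [hR]
    by_cases hB : ∀ s ∈ 𝒳, ‖ψ ω s - φ s‖ ≤ δ
    · have hloc : ∀ i ≤ I, (∀ k, i ≤ k → k ≤ I → ¬ A k ω) → (κ : ℝ) ≤ cnt i ω := by
        intro i hiI hk
        have h1 := hk i le_rfl hiI
        simp only [hA, not_or, not_not] at h1
        refine Nat.cast_le.2 (hits_le_hits fun j hj => ?_)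
        refine norm_lt_of_mem_catchment hS ht hiI hε hε' h1.1 (fun k h2 h3 s hs => ?_) hδ hB hM hMn
          hx (hZω j) (fun i => hXω i) hj
        have h4 := hk k h2 h3
        simp only [hA, not_or, not_exists, not_and, not_lt] at h4
        exact h4.2 s hs
      have htop : (κ : ℝ) ≤ l (I + 1) := by
        refine hκK.trans ?_
        have := mul_le_mul_of_nonneg_left hCtop hK0.le
        simp only [hl]
        linarith
      have hpow := pow_le_of_dyadic_localization (Nat.cast_nonneg κ) hl0 hloc htop p
      have hfirst : (8 * C * ((n : ℝ) / M * t ^ m)) ^ p = (2 * a) ^ p * l 0 ^ p := by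
        rw [← mul_pow, ← haK]
        simp only [hl]
        ring
      have hsum : ENNReal.ofReal ((a * κ) ^ p) ≤ ENNReal.ofReal ((2 * a) ^ p) *
          (ENNReal.ofReal (l 0 ^ p) + (∑ i ∈ Finset.range (I + 1),
            ENNReal.ofReal (max (cnt i ω - l i) 0 ^ p) + ∑ i ∈ Finset.range (I + 1),
              ENNReal.ofReal (if A i ω then l (i + 1) ^ p else 0))) := by
        have hn1 : ∀ i ∈ Finset.range (I + 1), 0 ≤ max (cnt i ω - l i) 0 ^ p := fun i _ =>
          pow_nonneg (le_max_right _ _) _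
        have hn2 : ∀ i ∈ Finset.range (I + 1), 0 ≤ if A i ω then l (i + 1) ^ p else 0 :=
          fun i _ => by
            split_ifs
            · exact pow_nonneg (hl0 _) _
            · exact le_rfl
        rw [← ENNReal.ofReal_sum_of_nonneg hn1, ← ENNReal.ofReal_sum_of_nonneg hn2,
          ← ENNReal.ofReal_add (Finset.sum_nonneg hn1) (Finset.sum_nonneg hn2),
          ← ENNReal.ofReal_add (pow_nonneg (hl0 0) p)
            (add_nonneg (Finset.sum_nonneg hn1) (Finset.sum_nonneg hn2)),
          ← ENNReal.ofReal_mul (by positivity)]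
        refine ENNReal.ofReal_le_ofReal ?_
        rw [mul_pow, mul_pow, mul_comm ((2 : ℝ) ^ p), mul_assoc]
        exact mul_le_mul_of_nonneg_left hpow (by positivity)
      refine hsum.trans ?_
      rw [hfirst, ENNReal.ofReal_mul (by positivity), mul_add]
      refine add_le_add le_rfl (le_add_right ?_)
      gcongr with i hi
      split_ifs with hAi
      · have : ω ∈ A' i := subset_toMeasurable _ _ hAi
        simp [this]
      · simp
    · have hBm : ω ∈ B' := subset_toMeasurable _ _ hB
      rw [Set.indicator_of_mem hBm, mul_one]
      refine le_add_left (le_add_left (ENNReal.ofReal_le_ofReal ?_))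
      rw [← haK]
      gcongr
  · rw [lintegral_add_right _ hbm, lintegral_const_mul' _ _ ENNReal.ofReal_ne_top,
      lintegral_const_mul' _ _ ENNReal.ofReal_ne_top,
      lintegral_indicator_const (measurableSet_toMeasurable _ _), one_mul, measure_toMeasurable,
      lintegral_add_right' _ (Finset.aemeasurable_fun_sum _ fun i _ => him i),
      lintegral_finsetSum' _ fun i _ => hem i, lintegral_finsetSum' _ fun i _ => him i, mul_add]
    refine add_le_add (add_le_add ?_ ?_) le_rfl
    · gcongr with i hi
      exact lintegral_hits_excess_le hW hindW measurableSet_ball K hp (by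
        gcongr
        exact hν₁ i (Nat.lt_succ_iff.1 (Finset.mem_range.1 hi)))
    · rw [Finset.mul_sum, Finset.mul_sum]
      refine Finset.sum_le_sum fun i hi => ?_
      rw [lintegral_const_mul' _ _ ENNReal.ofReal_ne_top,
        lintegral_indicator_const (measurableSet_toMeasurable _ _), one_mul, measure_toMeasurable,
        ← mul_assoc, ← mul_assoc, ← ENNReal.ofReal_mul (by positivity),
        ← ENNReal.ofReal_mul (by positivity)]
      refine mul_le_mul' (le_of_eq ?_) ?_
      · rw [← mul_pow, ← mul_pow, ← haK]
        simp only [hl]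
        congr 2
        rw [pow_succ 2 i, mul_pow, mul_pow, mul_pow]
        ring
      · refine (measure_mono (fun ω hω => hω)).trans ((measure_union_le _ _).trans
          (add_le_add le_rfl ?_))
        exact measure_exists_hits_lt_le hY hindY
          (hν₀ i (Nat.lt_succ_iff.1 (Finset.mem_range.1 hi))) hct

end Domination

/-! ### From either assumption on the estimator to the dyadic condition. -/

section ErrorCondition

variable {Ω : Type*} {d m : ℕ} {N₁ : ℕ → ℕ}

/-- The dyadic form of the conditions on the estimation error: the relative increments of the error
are controlled on all dyadic scales `2ⁱ t ≤ 1` at once, and the error itself is small. -/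
def DyadicErrorCondition [MeasurableSpace Ω] (P : Measure Ω) (𝒳 : Set (E d)) (φ : E d → E m)
    (ψ : ℕ → Ω → E d → E m) (M : ℕ → ℕ) (p : ℕ) : Prop :=
  ∀ ε : ℝ, 0 < ε → ∃ a : ℕ → ℝ≥0∞, Tendsto a atTop (𝓝 0) ∧ ∀ n : ℕ,
    (∀ (t : ℝ) (I : ℕ), 0 < t → 2 ^ I * t ≤ 1 →
      ∑ i ∈ Finset.range (I + 1), ENNReal.ofReal (((n : ℝ) / M n * (2 ^ i * t) ^ m) ^ p) *
        P {ω | ¬ IncrementBound 𝒳 φ (ψ n ω) ε (2 ^ i * t)} ≤ a n) ∧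
    ENNReal.ofReal (((n : ℝ) / M n) ^ p) * P {ω | ¬ ∀ s ∈ 𝒳, ‖ψ n ω s - φ s‖ ≤ ε} ≤ a n

lemma refitted_self (φhat : Estimator d m N₁) (X Z : ℕ → Ω → E d) (p n : ℕ) (ω : Ω) :
    refitted φhat X Z (fun k : Fin p => Z k ω) n ω = fitted φhat X Z n ω := by
  unfold refitted fitted
  congr 1
  funext j
  by_cases h : (j : ℕ) < p <;> simp [replaceFirst, h]

lemma enorm_le_ofReal_iff {F : Type*} [SeminormedAddCommGroup F] {v : F} {ε : ℝ} (hε : 0 ≤ ε) :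
    ‖v‖ₑ ≤ ENNReal.ofReal ε ↔ ‖v‖ ≤ ε := by
  rw [← ofReal_norm, ENNReal.ofReal_le_ofReal_iff hε]

lemma norm_le_of_supDist_le {𝒳 : Set (E d)} {ψ φ : E d → E m} {ε : ℝ} (hε : 0 ≤ ε)
    (h : supDist 𝒳 ψ φ ≤ ENNReal.ofReal ε) : ∀ s ∈ 𝒳, ‖ψ s - φ s‖ ≤ ε := fun s hs =>
  (enorm_le_ofReal_iff hε).1 ((le_iSup₂ (f := fun s (_ : s ∈ 𝒳) => ‖ψ s - φ s‖ₑ) s hs).trans h)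

/-- The actual sample is one of the admissible replacements, so the suprema over `𝒵ᵖ` control the
original estimator. -/
lemma supDist_fitted_le_supError {𝒳 𝒵 : Set (E d)} {φ : E d → E m} (φhat : Estimator d m N₁)
    {X Z : ℕ → Ω → E d} {ω : Ω} (hZ : ∀ j, Z j ω ∈ 𝒵) (p n : ℕ) :
    supDist 𝒳 (fitted φhat X Z n ω) φ ≤ supError 𝒳 𝒵 φ φhat X Z p n ω := by
  rw [← refitted_self φhat X Z p n ω]
  exact le_iSup₂ (f := fun (z : Fin p → E d) (_ : ∀ k, z k ∈ 𝒵) =>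
    supDist 𝒳 (refitted φhat X Z z n ω) φ) (fun k : Fin p => Z k ω) (fun k => hZ k)

lemma incrementBound_of_norm_le {𝒳 : Set (E d)} {φ ψ : E d → E m} {ε u : ℝ} (hε : 0 ≤ ε)
    (h : ∀ s ∈ 𝒳, ‖ψ s - φ s‖ ≤ ε * u / 2) : IncrementBound 𝒳 φ ψ ε u := fun s hs t ht => by
  have h1 := norm_sub_le (ψ s - φ s) (ψ t - φ t)
  have h2 := mul_le_mul_of_nonneg_left (le_max_left u ‖φ s - φ t‖) hε
  linarith [h s hs, h t ht]

lemma incrementBound_of_relOscillation_le {𝒳 𝒵 : Set (E d)} {φ : E d → E m}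
    {φhat : Estimator d m N₁} {X Z : ℕ → Ω → E d} {ω : Ω} (hZ : ∀ j, Z j ω ∈ 𝒵) {p n : ℕ}
    {ε u : ℝ} (hε : 0 ≤ ε) (hu : 0 < u)
    (h : relOscillation 𝒳 𝒵 φ φhat X Z p n u ω ≤ ENNReal.ofReal ε) :
    IncrementBound 𝒳 φ (fitted φhat X Z n ω) ε u := by
  intro s hs t ht
  have hδ : 0 < max u ‖φ s - φ t‖ := lt_max_of_lt_left hu
  have h1 : ENNReal.ofReal (max u ‖φ s - φ t‖)⁻¹ *
      ‖(fitted φhat X Z n ω s - φ s) - (fitted φhat X Z n ω t - φ t)‖ₑ ≤ ENNReal.ofReal ε := by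
    refine le_trans ?_ h
    unfold relOscillation
    refine le_iSup₂_of_le (max u ‖φ s - φ t‖) (le_max_left _ _) (mul_le_mul' le_rfl ?_)
    refine le_iSup₂_of_le s hs (le_iSup₂_of_le t ht (le_iSup_of_le (le_max_right _ _) ?_))
    refine le_iSup₂_of_le (fun k : Fin p => Z k ω) (fun k => hZ k) ?_
    rw [refitted_self]
  rw [← ofReal_norm, ← ENNReal.ofReal_mul (by positivity),
    ENNReal.ofReal_le_ofReal_iff hε, inv_mul_le_iff₀ hδ] at h1
  linarith

lemma relOscillation_antitone {𝒳 𝒵 : Set (E d)} {φ : E d → E m} {φhat : Estimator d m N₁}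
    {X Z : ℕ → Ω → E d} {ω : Ω} {p n : ℕ} {u v : ℝ} (huv : u ≤ v) :
    relOscillation 𝒳 𝒵 φ φhat X Z p n v ω ≤ relOscillation 𝒳 𝒵 φ φhat X Z p n u ω :=
  iSup_mono fun _ => iSup_le fun h => le_iSup_of_le (huv.trans h) le_rfl

lemma sum_two_pow_mul_pow_le (x : ℝ≥0∞) {a : ℕ} (ha : 1 ≤ a) (n : ℕ) :
    ∑ i ∈ Finset.range (n + 1), (2 ^ i * x) ^ a ≤ 2 * (2 ^ n * x) ^ a := by
  induction n with
  | zero =>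
    simp only [zero_add, Finset.range_one, Finset.sum_singleton]
    exact le_mul_of_one_le_left (zero_le) (by norm_num)
  | succ n ih =>
    rw [Finset.sum_range_succ, two_mul]
    refine add_le_add (ih.trans ?_) le_rfl
    rw [pow_succ' 2 n, mul_assoc, mul_pow 2]
    gcongr
    exact le_self_pow₀ (by norm_num) (by omega)

-- A dyadic layer-cake bound: the last scale below `v` dominates the geometric sum. It converts a
-- sum of tail probabilities into one moment.
open Classical in
lemma sum_two_pow_mul_pow_ite_le (x v : ℝ≥0∞) {a : ℕ} (ha : 1 ≤ a) (n : ℕ) :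
    ∑ i ∈ Finset.range n, (if 2 ^ i * x < v then (2 ^ i * x) ^ a else 0) ≤ 2 * v ^ a := by
  induction n with
  | zero => simp
  | succ n ih =>
    by_cases h : 2 ^ n * x < v
    · calc ∑ i ∈ Finset.range (n + 1), (if 2 ^ i * x < v then (2 ^ i * x) ^ a else 0)
          ≤ ∑ i ∈ Finset.range (n + 1), (2 ^ i * x) ^ a := by
            refine Finset.sum_le_sum fun i _ => ?_
            split_ifs
            · exact le_rfl
            · exact zero_le
        _ ≤ 2 * (2 ^ n * x) ^ a := sum_two_pow_mul_pow_le x ha n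
        _ ≤ 2 * v ^ a := by gcongr
    · rw [Finset.sum_range_succ, if_neg h, add_zero]
      exact ih

variable [MeasurableSpace Ω]

/-- A uniform error of at most `ε u / 2` gives the increment bound at scale `u`. The weighted sum of
tails over scales is thus a moment of order `pq` of the error; the uniform part is Markov's
inequality. -/
lemma UniformErrorCondition.dyadicErrorCondition {P : Measure Ω} {𝒳 𝒵 : Set (E d)} {φ : E d → E m}
    {φhat : Estimator d m N₁} {X Z : ℕ → Ω → E d} {M : ℕ → ℕ} {p q : ℕ} (hp : 1 ≤ p) (hq : 1 ≤ q)
    (hqm : q ≤ m) (hZ : ∀ᵐ ω ∂P, ∀ j, Z j ω ∈ 𝒵)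
    (h : UniformErrorCondition P 𝒳 𝒵 φ φhat X Z M p q) :
    DyadicErrorCondition P 𝒳 φ (fitted φhat X Z) M p := by
  classical
  intro ε hε
  obtain ⟨hmeas, hlim⟩ := h
  set J : ℕ → ℝ≥0∞ := fun n =>
    ∫⁻ ω, ENNReal.ofReal ((n : ℝ) / M n) ^ p * supError 𝒳 𝒵 φ φhat X Z p n ω ^ (p * q) ∂P with hJ
  have hJ' : ∀ n, J n = ENNReal.ofReal ((n : ℝ) / M n) ^ p *
      ∫⁻ ω, supError 𝒳 𝒵 φ φhat X Z p n ω ^ (p * q) ∂P := fun n =>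
    lintegral_const_mul' _ _ (ENNReal.pow_ne_top ENNReal.ofReal_ne_top)
  have hpq : 1 ≤ p * q := Nat.mul_pos hp hq
  set C₁ : ℝ≥0∞ := 2 * ENNReal.ofReal (2 / ε) ^ (p * q) with hC₁
  set C₂ : ℝ≥0∞ := (ENNReal.ofReal ε ^ (p * q))⁻¹ with hC₂
  have hC₁' : C₁ ≠ ∞ := ENNReal.mul_ne_top (by simp) (ENNReal.pow_ne_top ENNReal.ofReal_ne_top)
  have hC₂' : C₂ ≠ ∞ := ENNReal.inv_ne_top.2 (pow_ne_zero _ (by simpa using hε))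
  refine ⟨fun n => (C₁ + C₂) * J n, ?_, fun n => ⟨fun t I ht hI => ?_, ?_⟩⟩
  · have := ENNReal.Tendsto.const_mul hlim (Or.inr (ENNReal.add_ne_top.2 ⟨hC₁', hC₂'⟩))
    simpa using this
  · refine le_trans ?_ (mul_le_mul' le_self_add (le_refl (J n)))
    set ξ := supError 𝒳 𝒵 φ φhat X Z p n with hξ
    set v : Ω → ℝ≥0∞ := fun ω => ENNReal.ofReal (2 / ε) * ξ ω with hv
    have hvm : AEMeasurable v P := (hmeas n).const_mul _
    have hsub : ∀ i, P {ω | ¬ IncrementBound 𝒳 φ (fitted φhat X Z n ω) ε (2 ^ i * t)} ≤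
        P {ω | 2 ^ i * ENNReal.ofReal t < v ω} := by
      intro i
      refine measure_mono_ae ?_
      filter_upwards [hZ] with ω hω hinc
      by_contra hcon
      have hle : v ω ≤ 2 ^ i * ENNReal.ofReal t := not_lt.1 hcon
      refine hinc (incrementBound_of_norm_le hε.le (norm_le_of_supDist_le (by positivity)
        ((supDist_fitted_le_supError φhat hω p n).trans ?_)))
      have hmul : ξ ω = ENNReal.ofReal (ε / 2) * v ω := by
        rw [hv, ← mul_assoc, ← ENNReal.ofReal_mul (by positivity)]
        have : ε / 2 * (2 / ε) = 1 := by field_simp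
        rw [this, ENNReal.ofReal_one, one_mul]
      change ξ ω ≤ _
      rw [hmul]
      refine (mul_le_mul' le_rfl hle).trans (le_of_eq ?_)
      have h2 : (2 : ℝ≥0∞) ^ i = ENNReal.ofReal (2 ^ i) := by
        rw [ENNReal.ofReal_pow (by norm_num)]; simp
      rw [h2, ← ENNReal.ofReal_mul (by positivity), ← ENNReal.ofReal_mul (by positivity)]
      congr 1
      ring
    have hterm : ∀ i ∈ Finset.range (I + 1),
        ENNReal.ofReal (((n : ℝ) / M n * (2 ^ i * t) ^ m) ^ p) *
          P {ω | ¬ IncrementBound 𝒳 φ (fitted φhat X Z n ω) ε (2 ^ i * t)} ≤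
        ENNReal.ofReal ((n : ℝ) / M n) ^ p * ∫⁻ ω, (if 2 ^ i * ENNReal.ofReal t < v ω then
          (2 ^ i * ENNReal.ofReal t) ^ (p * q) else 0) ∂P := by
      intro i hi
      have hset : NullMeasurableSet {ω | 2 ^ i * ENNReal.ofReal t < v ω} P :=
        nullMeasurableSet_lt aemeasurable_const hvm
      have hint : ∫⁻ ω, (if 2 ^ i * ENNReal.ofReal t < v ω then
          (2 ^ i * ENNReal.ofReal t) ^ (p * q) else 0) ∂P =
          (2 ^ i * ENNReal.ofReal t) ^ (p * q) * P {ω | 2 ^ i * ENNReal.ofReal t < v ω} := by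
        rw [← lintegral_indicator_const₀ hset]
        refine lintegral_congr fun ω => ?_
        simp [Set.indicator_apply]
      have hti : 2 ^ i * t ≤ 1 := by
        refine le_trans ?_ hI
        gcongr
        · norm_num
        · exact Nat.lt_succ_iff.1 (Finset.mem_range.1 hi)
      rw [hint, ← mul_assoc]
      refine mul_le_mul' ?_ (hsub i)
      have h2 : (2 : ℝ≥0∞) ^ i = ENNReal.ofReal (2 ^ i) := by
        rw [ENNReal.ofReal_pow (by norm_num)]; simp
      rw [h2, ← ENNReal.ofReal_mul (by positivity), ← ENNReal.ofReal_pow (by positivity),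
        ← ENNReal.ofReal_pow (by positivity), ← ENNReal.ofReal_mul (by positivity)]
      refine ENNReal.ofReal_le_ofReal ?_
      rw [mul_pow _ _ p, ← pow_mul, mul_comm m p]
      gcongr ?_ * ?_
      -- All scales are at most `1`, so the exponent `m` may be lowered to `q`.
      exact pow_le_pow_of_le_one (by positivity) hti (Nat.mul_le_mul_left p hqm)
    refine (Finset.sum_le_sum hterm).trans ?_
    have hitem : ∀ i ∈ Finset.range (I + 1), AEMeasurable (fun ω =>
        if 2 ^ i * ENNReal.ofReal t < v ω then (2 ^ i * ENNReal.ofReal t) ^ (p * q) else 0) P := by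
      intro i _
      have : (fun ω => if 2 ^ i * ENNReal.ofReal t < v ω then
          (2 ^ i * ENNReal.ofReal t) ^ (p * q) else 0) =
          (fun y : ℝ≥0∞ => if 2 ^ i * ENNReal.ofReal t < y then
            (2 ^ i * ENNReal.ofReal t) ^ (p * q) else 0) ∘ v := rfl
      rw [this]
      exact (Measurable.ite measurableSet_Ioi measurable_const measurable_const).comp_aemeasurable
        hvm
    rw [← Finset.mul_sum, ← lintegral_finsetSum' _ hitem, hJ', mul_left_comm]
    gcongr
    rw [← lintegral_const_mul' _ _ hC₁']
    refine lintegral_mono fun ω => ?_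
    refine (sum_two_pow_mul_pow_ite_le _ _ hpq _).trans (le_of_eq ?_)
    rw [hv, hC₁, mul_pow, mul_assoc]
  · refine le_trans ?_ (mul_le_mul' le_add_self (le_refl (J n)))
    have hsub : P {ω | ¬ ∀ s ∈ 𝒳, ‖fitted φhat X Z n ω s - φ s‖ ≤ ε} ≤
        P {ω | ENNReal.ofReal ε ^ (p * q) ≤ supError 𝒳 𝒵 φ φhat X Z p n ω ^ (p * q)} := by
      refine measure_mono_ae ?_
      filter_upwards [hZ] with ω hω hinc
      by_contra hcon
      refine hinc (norm_le_of_supDist_le hε.le ((supDist_fitted_le_supError φhat hω p n).trans ?_))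
      by_contra hlt
      exact hcon (pow_le_pow_left' (not_le.1 hlt).le _)
    have hmk := mul_meas_ge_le_lintegral₀ ((hmeas n).pow_const (p * q)) (ENNReal.ofReal ε ^ (p * q))
    rw [hJ', mul_left_comm, ENNReal.ofReal_pow (by positivity)]
    gcongr
    refine hsub.trans ?_
    rw [hC₂, ← ENNReal.div_eq_inv_mul, ENNReal.le_div_iff_mul_le, mul_comm]
    · exact hmk
    · exact Or.inl (pow_ne_zero _ (by simpa using hε))
    · exact Or.inl (ENNReal.pow_ne_top ENNReal.ofReal_ne_top)

/-- Compare the sum with the integral over the blocks `(b i, b (i + 1)]`, each at least as long as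
`b i`. Monotonicity is needed only of `τ`, the actual tail; the majorant `g` may be arbitrary. -/
lemma sum_dyadic_le_lintegral {g τ : ℝ → ℝ≥0∞} (hm : 1 ≤ m) (hτ : Antitone τ)
    (hg : ∀ u, 0 < u → τ u ≤ g u) {p : ℕ} (hp : 1 ≤ p) {t : ℝ} (ht : 0 < t) (I : ℕ) :
    ∑ i ∈ Finset.range I, ENNReal.ofReal (((2 ^ i * t / 2) ^ m) ^ p) * τ (2 ^ i * t) ≤
      ∫⁻ u in Set.Ioi (0 : ℝ), ENNReal.ofReal (u ^ (p - 1)) * g (u ^ (1 / (m : ℝ))) := by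
  set b : ℕ → ℝ := fun i => (2 ^ i * t / 2) ^ m with hb
  have hb0 : ∀ i, 0 < b i := fun i => by positivity
  have hbs : ∀ i, b (i + 1) = (2 ^ i * t) ^ m := fun i => by
    simp only [hb]
    congr 1
    rw [pow_succ]
    ring
  have hb2 : ∀ i, 2 * b i ≤ b (i + 1) := fun i => by
    rw [hbs]
    simp only [hb]
    rw [div_pow, mul_div_assoc', div_le_iff₀ (by positivity), mul_comm]
    gcongr
    exact le_self_pow₀ (by norm_num) (by omega)
  have hbm : Monotone b := monotone_nat_of_le_succ fun i => by linarith [hb2 i, hb0 i]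
  have hdisj : Pairwise (Function.onFun Disjoint fun i => Set.Ioc (b i) (b (i + 1))) :=
    hbm.pairwise_disjoint_on_Ioc_succ
  calc ∑ i ∈ Finset.range I, ENNReal.ofReal (b i ^ p) * τ (2 ^ i * t)
      ≤ ∑ i ∈ Finset.range I, ∫⁻ u in Set.Ioc (b i) (b (i + 1)),
          ENNReal.ofReal (u ^ (p - 1)) * g (u ^ (1 / (m : ℝ))) := by
        refine Finset.sum_le_sum fun i _ => ?_
        calc ENNReal.ofReal (b i ^ p) * τ (2 ^ i * t)
            ≤ (ENNReal.ofReal (b i ^ (p - 1)) * τ (2 ^ i * t)) *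
                volume (Set.Ioc (b i) (b (i + 1))) := by
              rw [Real.volume_Ioc, mul_right_comm, ← ENNReal.ofReal_mul (by
                have := hb0 i; positivity)]
              gcongr
              obtain ⟨k, rfl⟩ : ∃ k, p = k + 1 := ⟨p - 1, by omega⟩
              rw [pow_succ, Nat.add_sub_cancel]
              have := hb0 i
              gcongr
              linarith [hb2 i]
          _ = ∫⁻ _ in Set.Ioc (b i) (b (i + 1)),
                ENNReal.ofReal (b i ^ (p - 1)) * τ (2 ^ i * t) := (setLIntegral_const _ _).symm
          _ ≤ _ := by
              refine setLIntegral_mono' measurableSet_Ioc fun u hu => ?_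
              have hu0 : 0 < u := (hb0 i).trans hu.1
              have hroot : u ^ (1 / (m : ℝ)) ≤ 2 ^ i * t := by
                rw [one_div, Real.rpow_inv_le_iff_of_pos hu0.le (by positivity) (by positivity),
                  Real.rpow_natCast, ← hbs]
                exact hu.2
              refine mul_le_mul' (ENNReal.ofReal_le_ofReal ?_) ?_
              · have := (hb0 i).le
                have := hu.1.le
                gcongr
              · exact (hτ hroot).trans (hg _ (by positivity))
    _ = ∫⁻ u in ⋃ i ∈ Finset.range I, Set.Ioc (b i) (b (i + 1)),
          ENNReal.ofReal (u ^ (p - 1)) * g (u ^ (1 / (m : ℝ))) :=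
        (lintegral_biUnion_finset (fun i _ j _ hij => hdisj hij)
          (fun _ _ => measurableSet_Ioc) _).symm
    _ ≤ _ := by
        refine lintegral_mono_set (Set.iUnion₂_subset fun i _ u hu => ?_)
        exact (hb0 i).trans hu.1

/-- The relative oscillation decreases in the scale, so its tail can play the role of `τ`. The
halved scales in the comparison with the integral cost the factor `(2ᵐ)ᵖ`. -/
lemma OscillationCondition.dyadicErrorCondition {P : Measure Ω} {𝒳 𝒵 : Set (E d)} {φ : E d → E m}
    {φhat : Estimator d m N₁} {X Z : ℕ → Ω → E d} {M : ℕ → ℕ} {p : ℕ} (hm : 1 ≤ m) (hp : 1 ≤ p)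
    (hZ : ∀ᵐ ω ∂P, ∀ j, Z j ω ∈ 𝒵) (h : OscillationCondition P 𝒳 𝒵 φ φhat X Z M p) :
    DyadicErrorCondition P 𝒳 φ (fitted φhat X Z) M p := by
  intro ε hε
  obtain ⟨⟨T, hT, hTlim⟩, hsup⟩ := h ε hε
  have hlim := hTlim p (Finset.mem_Icc.2 ⟨hp, le_rfl⟩)
  set J : ℕ → ℝ≥0∞ := fun n => ENNReal.ofReal ((n : ℝ) / M n) ^ p *
    ∫⁻ u in Set.Ioi (0 : ℝ), ENNReal.ofReal (u ^ (p - 1)) * T n (u ^ (1 / (m : ℝ))) with hJ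
  set J' : ℕ → ℝ≥0∞ := fun n => ENNReal.ofReal ((n : ℝ) / M n) ^ p *
    P {ω | ENNReal.ofReal ε < supDist 𝒳 (fitted φhat X Z n ω) φ} with hJ'
  refine ⟨fun n => ENNReal.ofReal ((2 ^ m) ^ p) * J n + J' n, ?_,
    fun n => ⟨fun t I ht _ => ?_, ?_⟩⟩
  · have := (ENNReal.Tendsto.const_mul hlim
      (Or.inr (ENNReal.ofReal_ne_top (r := ((2 : ℝ) ^ m) ^ p)))).add hsup
    simpa using this
  · refine le_trans ?_ le_self_add
    set τ : ℝ → ℝ≥0∞ := fun u =>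
      P {ω | ENNReal.ofReal ε < relOscillation 𝒳 𝒵 φ φhat X Z p n u ω} with hτ
    have hanti : Antitone τ := fun u v huv =>
      measure_mono fun ω hω => lt_of_lt_of_le hω (relOscillation_antitone huv)
    have hsum := sum_dyadic_le_lintegral hm hanti (hT n) hp ht (I + 1)
    simp only [hJ]
    rw [mul_left_comm]
    refine le_trans ?_ (mul_le_mul' le_rfl (mul_le_mul' le_rfl hsum))
    rw [Finset.mul_sum, Finset.mul_sum]
    refine Finset.sum_le_sum fun i _ => ?_
    rw [← mul_assoc, ← mul_assoc, ← ENNReal.ofReal_pow (by positivity),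
      mul_assoc (ENNReal.ofReal _), ← ENNReal.ofReal_mul (by positivity),
      ← ENNReal.ofReal_mul (by positivity)]
    refine mul_le_mul' (le_of_eq ?_) ?_
    · congr 1
      rw [← mul_pow, ← mul_pow, div_pow]
      congr 1
      field_simp
    · refine measure_mono_ae ?_
      filter_upwards [hZ] with ω hω hinc
      by_contra hcon
      exact hinc (incrementBound_of_relOscillation_le hω hε.le (by positivity) (not_lt.1 hcon))
  · refine le_trans ?_ le_add_self
    simp only [hJ']
    rw [ENNReal.ofReal_pow (by positivity)]
    gcongr with ω
    intro hinc
    by_contra hcon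
    exact hinc (norm_le_of_supDist_le hε.le (not_lt.1 hcon))

end ErrorCondition

/-! ### The bandwidth and its limit. -/

section Scale

/-- The bandwidth `(M / n)^{1/m}`. -/
def bandwidth (m : ℕ) (M : ℕ → ℕ) (n : ℕ) : ℝ := ((M n : ℝ) / n) ^ (1 / (m : ℝ))

lemma bandwidth_pow {m : ℕ} (hm : 1 ≤ m) (M : ℕ → ℕ) (n : ℕ) :
    bandwidth m M n ^ m = (M n : ℝ) / n := by
  rw [bandwidth, one_div, Real.rpow_inv_natCast_pow (by positivity) (by omega)]

lemma bandwidth_pos {m : ℕ} {M : ℕ → ℕ} {n : ℕ} (hM : 1 ≤ M n) (hn : 1 ≤ n) :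
    0 < bandwidth m M n := by
  have : (0 : ℝ) < M n := by exact_mod_cast hM
  have : (0 : ℝ) < n := by exact_mod_cast hn
  unfold bandwidth
  positivity

lemma tendsto_bandwidth {m : ℕ} (hm : 1 ≤ m) {M : ℕ → ℕ}
    (h : Tendsto (fun n : ℕ => (M n : ℝ) / n) atTop (𝓝 0)) :
    Tendsto (bandwidth m M) atTop (𝓝 0) := by
  have hm' : (0 : ℝ) < 1 / (m : ℝ) := by positivity
  have := h.rpow_const (p := 1 / (m : ℝ)) (Or.inr hm'.le)
  rwa [Real.zero_rpow hm'.ne'] at this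

lemma tendsto_div_of_tendsto_mul_log_div {M : ℕ → ℕ}
    (h : Tendsto (fun n : ℕ => (M n : ℝ) * Real.log n / n) atTop (𝓝 0)) :
    Tendsto (fun n : ℕ => (M n : ℝ) / n) atTop (𝓝 0) := by
  refine squeeze_zero' (Eventually.of_forall fun n => by positivity) ?_ h
  filter_upwards [eventually_ge_atTop 3] with n hn
  have h3 : (3 : ℝ) ≤ n := by exact_mod_cast hn
  have hlog : 1 ≤ Real.log n := by
    rw [Real.le_log_iff_exp_le (by linarith)]
    linarith [Real.exp_one_lt_d9]
  gcongr
  exact le_mul_of_one_le_right (Nat.cast_nonneg _) hlog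

lemma tendsto_measure_of_le {Ω : Type*} [MeasurableSpace Ω] {P : Measure Ω} {A : ℕ → Set Ω}
    {b : ℕ → ℝ≥0∞} (hb : Tendsto b atTop (𝓝 0)) (h : ∀ᶠ n in atTop, P (A n) ≤ b n) :
    Tendsto (fun n => P (A n)) atTop (𝓝 0) :=
  tendsto_of_tendsto_of_tendsto_of_le_of_le' tendsto_const_nhds hb
    (Eventually.of_forall fun _ => zero_le) h

end Scale

/-! ### Local mass bounds on all small scales. -/

section LocalMass

variable {m : ℕ} {ν₀ ν₁ : Measure (E m)} {f₀ f₁ : E m → ℝ≥0} {c : E m}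

lemma exists_local_mass_bounds (hν₀ : ν₀ = volume.withDensity fun u => (f₀ u : ℝ≥0∞))
    (hν₁ : ν₁ = volume.withDensity fun u => (f₁ u : ℝ≥0∞)) (hpos : 0 < f₀ c)
    (hc₀ : ContinuousAt f₀ c) (hc₁ : ContinuousAt f₁ c) :
    ∃ u₀ c₀ C : ℝ, 0 < u₀ ∧ u₀ ≤ 1 ∧ 0 < c₀ ∧ 0 < C ∧ 1 ≤ 4 * C * u₀ ^ m ∧
      ∀ t, 0 < t → t ≤ u₀ →
        (∀ s : E m, ‖s‖ ≤ 1 → c₀ * t ^ m ≤ ν₀.real (Metric.ball (c + t • s) (t / 4))) ∧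
        ν₁.real (Metric.ball c t) ≤ C * t ^ m := by
  have hf : (0 : ℝ) < f₀ c := hpos
  obtain ⟨r₀, hr₀, h₀⟩ := exists_measureReal_ball_bounds hν₀ hc₀ (half_pos hf)
  obtain ⟨r₁, hr₁, h₁⟩ := exists_measureReal_ball_bounds hν₁ hc₁ one_pos
  set V := volume.real (Metric.ball (0 : E m) 1) with hV
  have hV0 : 0 < V := volume_real_unit_ball_pos m
  have hu₀ : 0 < min 1 (min (r₀ / 2) r₁) := by positivity
  set u₀ := min 1 (min (r₀ / 2) r₁) with hu
  have hu1 : u₀ ≤ 1 := min_le_left _ _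
  have hu2 : u₀ ≤ r₀ / 2 := (min_le_right _ _).trans (min_le_left _ _)
  have hu3 : u₀ ≤ r₁ := (min_le_right _ _).trans (min_le_right _ _)
  -- The second entry of the maximum makes the bound at the top scale exceed the total mass, so the
  -- trivial bound by the sample size suffices there.
  refine ⟨u₀, f₀ c / 2 * (V * (1 / 4) ^ m), max ((f₁ c + 1) * V) (1 / (4 * u₀ ^ m)), hu₀, hu1,
    by positivity, lt_max_of_lt_right (by positivity), ?_, fun t ht htu => ⟨fun s hs => ?_, ?_⟩⟩
  · have := mul_le_mul_of_nonneg_right (le_max_right ((f₁ c + 1) * V) (1 / (4 * u₀ ^ m)))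
      (by positivity : 0 ≤ 4 * u₀ ^ m)
    rw [one_div_mul_cancel (by positivity)] at this
    linarith
  · have hsub : Metric.ball (c + t • s) (t / 4) ⊆ Metric.ball c r₀ := by
      refine Metric.ball_subset_ball' ?_
      rw [dist_eq_norm, add_sub_cancel_left, norm_smul, Real.norm_of_nonneg ht.le]
      nlinarith
    refine le_trans (le_of_eq ?_) (h₀ _ (t / 4) (by positivity) hsub).1
    rw [div_pow, div_pow]
    ring
  · refine (h₁ c t ht (Metric.ball_subset_ball (htu.trans hu3))).2.trans ?_
    rw [← mul_assoc]
    gcongr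
    exact le_max_left _ _

end LocalMass

/-! ### Weak law for counts in shrinking balls. -/

section LawOfLargeNumbers

variable {Ω : Type*} [MeasurableSpace Ω] {P : Measure Ω} [IsProbabilityMeasure P] {m : ℕ}

lemma tendsto_measure_hits_ball {Y : ℕ → Ω → E m} {ν : Measure (E m)} {f : E m → ℝ≥0}
    (hY : ∀ i, HasLaw (Y i) ν P) (hind : iIndepFun Y P)
    (hν : ν = volume.withDensity fun u => (f u : ℝ≥0∞)) {c : E m} (hc : ContinuousAt f c)
    {N : ℕ → ℕ} {H : ℕ → ℝ} (hH : ∀ᶠ n in atTop, 0 < H n) (hH0 : Tendsto H atTop (𝓝 0))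
    (hNH : Tendsto (fun n => N n * H n ^ m) atTop atTop) (v : E m) {β θ : ℝ} (hβ : 0 < β)
    (hθ : 0 < θ) :
    Tendsto (fun n => P {ω | θ ≤ |(hits (Metric.ball (c + H n • v) (β * H n))
      (fun i : Fin (N n) => Y i ω) : ℝ) / (N n * H n ^ m) -
        f c * (volume.real (Metric.ball (0 : E m) 1) * β ^ m)|}) atTop (𝓝 0) := by
  set V := volume.real (Metric.ball (0 : E m) 1) with hV
  have hV0 : 0 < V := volume_real_unit_ball_pos m
  -- With this oscillation of the density the bias is at most `θ/2`; Chebyshev is applied to the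
  -- other half.
  set δ : ℝ := θ / (2 * (V * β ^ m)) with hδ
  have hδ0 : 0 < δ := by positivity
  have hδθ : δ * (V * β ^ m) = θ / 2 := by rw [hδ]; field_simp
  obtain ⟨r, hr, hball⟩ := exists_measureReal_ball_bounds hν hc hδ0
  set D : ℝ := (f c + δ) * (V * β ^ m) / (θ / 2) ^ 2 with hD
  have hlim : Tendsto (fun n => ENNReal.ofReal (D / (N n * H n ^ m))) atTop (𝓝 0) := by
    have := ENNReal.tendsto_ofReal (hNH.const_div_atTop D)
    rwa [ENNReal.ofReal_zero] at this
  refine tendsto_measure_of_le hlim ?_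
  have hsmall : ∀ᶠ n in atTop, H n * (‖v‖ + β) < r := by
    have := hH0.mul_const (‖v‖ + β)
    rw [zero_mul] at this
    exact this.eventually_lt_const hr
  filter_upwards [hH, hsmall, hNH.eventually_gt_atTop 0] with n hHn hrn hNn
  set q := ν.real (Metric.ball (c + H n • v) (β * H n)) with hq
  set A : ℝ := N n * H n ^ m with hA
  have hb := hball (c + H n • v) (β * H n) (by positivity) (by
    refine Metric.ball_subset_ball' ?_
    rw [dist_eq_norm, add_sub_cancel_left, norm_smul, Real.norm_of_nonneg hHn.le]
    linarith)
  rw [← hV, ← hq, mul_pow] at hb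
  have hup : N n * q ≤ (f c + δ) * (V * β ^ m) * A := by
    have := mul_le_mul_of_nonneg_left hb.2 (Nat.cast_nonneg (N n))
    refine this.trans (le_of_eq ?_)
    rw [hA]; ring
  have hlo : (f c - δ) * (V * β ^ m) * A ≤ N n * q := by
    have := mul_le_mul_of_nonneg_left hb.1 (Nat.cast_nonneg (N n))
    refine le_trans (le_of_eq ?_) this
    rw [hA]; ring
  have hcheb := measure_abs_hits_sub_ge_le hY hind
    (measurableSet_ball (x := c + H n • v) (ε := β * H n)) (N n) (by positivity : 0 < θ / 2 * A)
  rw [← hq] at hcheb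
  refine le_trans (measure_mono fun ω hω => ?_) (hcheb.trans (ENNReal.ofReal_le_ofReal ?_))
  · rw [Set.mem_ofPred_eq] at hω ⊢
    set k : ℝ := (hits (Metric.ball (c + H n • v) (β * H n))
      (fun i : Fin (N n) => Y i ω) : ℝ) with hk
    have h1 : |N n * q - f c * (V * β ^ m) * A| ≤ θ / 2 * A := by
      rw [← hδθ, abs_le]
      constructor <;> linarith
    have h2 : θ * A ≤ |k - f c * (V * β ^ m) * A| := by
      have h3 : k - f c * (V * β ^ m) * A = (k / A - f c * (V * β ^ m)) * A := by
        field_simp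
      rw [h3, abs_mul, abs_of_pos hNn]
      gcongr
    have h4 := abs_sub_le k (N n * q) (f c * (V * β ^ m) * A)
    linarith
  · calc N n * q / (θ / 2 * A) ^ 2 ≤ (f c + δ) * (V * β ^ m) * A / (θ / 2 * A) ^ 2 := by gcongr
      _ = D / A := by rw [hD]; field_simp

end LawOfLargeNumbers

/-! ### The dominating variable as the sample size grows. -/

section AsymptoticDomination

variable {Ω : Type*} [MeasurableSpace Ω] {P : Measure Ω} [IsProbabilityMeasure P] {d m : ℕ}

lemma exists_nat_dyadic {t u : ℝ} (ht : 0 < t) (htu : t ≤ u) :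
    ∃ I : ℕ, 2 ^ I * t ≤ u ∧ u < 2 ^ (I + 1) * t := by
  obtain ⟨I, h1, h2⟩ := exists_nat_pow_near ((one_le_div ht).2 htu) (by norm_num : (1 : ℝ) < 2)
  exact ⟨I, (le_div_iff₀ ht).1 h1, (div_lt_iff₀ ht).1 h2⟩

lemma sum_exp_neg_le {a : ℝ} (ha : 0 < a) {m : ℕ} (hm : 1 ≤ m) (I : ℕ) :
    ∑ i ∈ Finset.range I, Real.exp (-(a * 2 ^ (i * m))) ≤ 2 / a := by
  simpa using sum_pow_mul_exp_neg_le ha hm 0 I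

/-- Start the dyadic scales at `t = L · bandwidth`, so that `(N₀/M) tᵐ = Lᵐ` stays constant. The
excess and net terms are then of orders `(N₀/(N₁M))ᵖ⁺¹` and `1/M`; the rest is given by the error
condition. -/
lemma exists_asymptotic_domination (hm : 1 ≤ m) {𝒳 𝒵 : Set (E d)} {φ : E d → E m}
    {X Z : ℕ → Ω → E d} {ν₀ ν₁ : Measure (E m)} [IsProbabilityMeasure ν₀] [IsProbabilityMeasure ν₁]
    (hY : ∀ i, HasLaw (φ ∘ X i) ν₀ P) (hindY : iIndepFun (fun i => φ ∘ X i) P)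
    (hW : ∀ i, HasLaw (φ ∘ Z i) ν₁ P) (hindW : iIndepFun (fun i => φ ∘ Z i) P)
    (hX𝒳 : ∀ᵐ ω ∂P, ∀ i, X i ω ∈ 𝒳) (hZ𝒳 : ∀ᵐ ω ∂P, ∀ j, Z j ω ∈ 𝒳)
    {f₀ f₁ : E m → ℝ≥0} (hν₀ : ν₀ = volume.withDensity fun u => (f₀ u : ℝ≥0∞))
    (hν₁ : ν₁ = volume.withDensity fun u => (f₁ u : ℝ≥0∞)) {x : E d} (hx : x ∈ 𝒳)
    (hpos : 0 < f₀ (φ x)) (hc₀ : ContinuousAt f₀ (φ x)) (hc₁ : ContinuousAt f₁ (φ x))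
    {N₁ M : ℕ → ℕ} (hMn : Tendsto (fun n : ℕ => (M n : ℝ) / n) atTop (𝓝 0))
    (hMN : Tendsto (fun n : ℕ => (M n : ℝ) * N₁ n / n) atTop atTop)
    (hM : Tendsto M atTop atTop) {p : ℕ} (hp : 1 ≤ p) {ψ : ℕ → Ω → E d → E m}
    (hψ : DyadicErrorCondition P 𝒳 φ ψ M p) :
    ∃ (C : ℝ) (b : ℕ → ℝ≥0∞), 0 ≤ C ∧ Tendsto b atTop (𝓝 0) ∧ ∀ᶠ n : ℕ in atTop,
      ∃ Y : Ω → ℝ≥0∞, AEMeasurable Y P ∧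
        (∀ᵐ ω ∂P, ENNReal.ofReal (ratioEst 𝒵 (M n) (ψ n ω) (fun i : Fin n => X i ω)
          (fun j : Fin (N₁ n) => Z j ω) x ^ p) ≤ ENNReal.ofReal C + Y ω) ∧
        ∫⁻ ω, Y ω ∂P ≤ b n := by
  obtain ⟨S, hS1, hS⟩ := exists_finset_net m 1 (by norm_num : (0 : ℝ) < 1 / 8)
  obtain ⟨u₀, c₀, C, hu₀, hu₁, hc₀', hC, hCu, hmass⟩ :=
    exists_local_mass_bounds hν₀ hν₁ hpos hc₀ hc₁
  obtain ⟨a, ha, hψa⟩ := hψ (1 / 32) (by norm_num)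
  -- The top scale satisfies `2^I t > u₀/2`, so `u₀/64` is below the admissible error `2^I t / 32`.
  obtain ⟨a', ha', hψa'⟩ := hψ (u₀ / 64) (by positivity)
  -- Large enough that `c₀ Lᵐ ≥ 4`, which gives the smallest net balls an expected count of at least
  -- `4M`.
  set L : ℝ := 1 + 4 / c₀ with hL
  have hL1 : 1 ≤ L := by rw [hL]; linarith [div_pos (by norm_num : (0 : ℝ) < 4) hc₀']
  have hL0 : 0 < L := by linarith
  have hLm : 4 ≤ c₀ * L ^ m := by
    have h1 : L ≤ L ^ m := le_self_pow₀ hL1 (by omega)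
    have h2 : 4 / c₀ ≤ L ^ m := by linarith
    rw [div_le_iff₀ hc₀'] at h2
    linarith
  have hMreal : Tendsto (fun n => (M n : ℝ)) atTop atTop := tendsto_natCast_atTop_atTop.comp hM
  set ρ : ℕ → ℝ := fun n => (n : ℝ) / (N₁ n * M n) with hρ
  have hρ0 : Tendsto ρ atTop (𝓝 0) := by
    refine hMN.inv_tendsto_atTop.congr fun n => ?_
    rw [Pi.inv_apply, inv_div, mul_comm]
  set b : ℕ → ℝ≥0∞ := fun n =>
    ENNReal.ofReal ((2 * ρ n) ^ p * (p.factorial * (ρ n / (C * L ^ m)))) +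
    ENNReal.ofReal ((8 * C * 2 ^ m) ^ p) *
      (a n + S.card * ENNReal.ofReal ((L ^ m) ^ p * (2 * (p + 1).factorial / M n))) + a' n with hb
  have hb0 : Tendsto b atTop (𝓝 0) := by
    have h1 : Tendsto (fun n => ENNReal.ofReal
        ((2 * ρ n) ^ p * (p.factorial * (ρ n / (C * L ^ m))))) atTop (𝓝 0) := by
      have := ENNReal.tendsto_ofReal (((hρ0.const_mul 2).pow p).mul
        ((hρ0.div_const (C * L ^ m)).const_mul (p.factorial : ℝ)))
      simpa using this
    have h2 : Tendsto (fun n => ENNReal.ofReal ((L ^ m) ^ p * (2 * (p + 1).factorial / M n)))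
        atTop (𝓝 0) := by
      have := ENNReal.tendsto_ofReal
        ((hMreal.const_div_atTop (2 * (p + 1).factorial : ℝ)).const_mul ((L ^ m) ^ p))
      simpa using this
    have h3 := ENNReal.Tendsto.const_mul h2 (Or.inr (ENNReal.natCast_ne_top S.card))
    have h4 := ENNReal.Tendsto.const_mul (ha.add h3)
      (Or.inr (ENNReal.ofReal_ne_top (r := (8 * C * 2 ^ m) ^ p)))
    have := (h1.add h4).add ha'
    simpa using this
  refine ⟨(8 * C * L ^ m) ^ p, b, by positivity, hb0, ?_⟩
  have hsmall : ∀ᶠ n in atTop, L * bandwidth m M n ≤ u₀ := by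
    have := (tendsto_bandwidth hm hMn).const_mul L
    rw [mul_zero] at this
    exact this.eventually_le_const hu₀
  filter_upwards [hM.eventually_ge_atTop 1, hMn.eventually_le_const one_pos,
    hMN.eventually_gt_atTop 0, hsmall, eventually_ge_atTop 1] with n hM1 hMn1 hN1 htu hn1
  have hn0 : (0 : ℝ) < n := by exact_mod_cast hn1
  have hM0 : (0 : ℝ) < M n := by exact_mod_cast hM1
  have hMle : M n ≤ n := by
    rw [div_le_one hn0] at hMn1
    exact_mod_cast hMn1
  have hK1 : 1 ≤ N₁ n := by
    by_contra hcon
    have : N₁ n = 0 := by omega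
    simp [this] at hN1
  have hK0 : (0 : ℝ) < N₁ n := by exact_mod_cast hK1
  have hh := bandwidth_pos (m := m) hM1 hn1
  have hhm := bandwidth_pow hm M n
  set t : ℝ := L * bandwidth m M n with ht
  have ht0 : 0 < t := by positivity
  have htm : t ^ m = L ^ m * (M n / n) := by rw [ht, mul_pow, hhm]
  have hGt : (n : ℝ) / M n * t ^ m = L ^ m := by rw [htm]; field_simp
  have htmi : ∀ i, (2 ^ i * t) ^ m = 2 ^ (i * m) * t ^ m := fun i => by
    rw [mul_pow, ← pow_mul]
  obtain ⟨I, hI1, hI2⟩ := exists_nat_dyadic ht0 htu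
  have hti : ∀ i ≤ I, 2 ^ i * t ≤ u₀ := fun i hi => by
    refine le_trans ?_ hI1
    gcongr
    norm_num
  obtain ⟨Y, hYm, hYae, hYint⟩ := exists_dominating_ratioEst (𝒵 := 𝒵) hY hindY hW hindW
    hX𝒳 hZ𝒳 hx (ψ n) hM1 hMle hK1 hp hS ht0 (I := I) (c₀ := c₀) hC
    (fun i hi s hs => (hmass _ (by positivity) (hti i hi)).1 s (hS1 s hs))
    (fun i hi => (hmass _ (by positivity) (hti i hi)).2)
    (by
      refine hCu.trans ?_
      gcongr)
    (by
      rw [htm]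
      have : (n : ℝ) * (c₀ * (L ^ m * (M n / n))) = c₀ * L ^ m * M n := by field_simp
      rw [this]
      gcongr)
    (ε := 1 / 32) (δ := u₀ / 64) (by norm_num) le_rfl (by
      rw [pow_succ] at hI2
      linarith)
  rw [hGt] at hYae
  refine ⟨Y, hYm, hYae, hYint.trans (add_le_add (add_le_add ?_ ?_) (hψa' n).2)⟩
  · have hα : 0 < 2 * (N₁ n * (C * t ^ m)) := by positivity
    rw [← ENNReal.ofReal_sum_of_nonneg fun i _ => by positivity, ← ENNReal.ofReal_mul (by positivity)]
    refine ENNReal.ofReal_le_ofReal ?_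
    rw [← Finset.mul_sum]
    have hs := sum_exp_neg_le hα hm (I + 1)
    have heq : ∀ i, 2 * (N₁ n * (C * (2 ^ i * t) ^ m)) = 2 * (N₁ n * (C * t ^ m)) * 2 ^ (i * m) :=
      fun i => by rw [htmi]; ring
    simp_rw [heq]
    gcongr
    refine hs.trans (le_of_eq ?_)
    rw [htm, hρ]
    field_simp
  · refine mul_le_mul' le_rfl ?_
    simp_rw [mul_add, Finset.sum_add_distrib]
    refine add_le_add ((hψa n).1 t I ht0 (hI1.trans hu₁)) ?_
    have hone : ∀ i ∈ Finset.range (I + 1), ENNReal.ofReal (((n : ℝ) / M n * (2 ^ i * t) ^ m) ^ p) *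
        (S.card * ENNReal.ofReal (Real.exp (-(M n * 2 ^ (i * m))))) ≤
        S.card * ENNReal.ofReal ((L ^ m) ^ p *
          ((M n * 2 ^ (i * m)) ^ p * Real.exp (-(M n * 2 ^ (i * m))))) := by
      intro i _
      rw [mul_left_comm, ← ENNReal.ofReal_mul (by positivity)]
      refine mul_le_mul' le_rfl (ENNReal.ofReal_le_ofReal ?_)
      have : (n : ℝ) / M n * (2 ^ i * t) ^ m = L ^ m * 2 ^ (i * m) := by
        rw [htmi, ← hGt]; ring
      rw [this, mul_pow, mul_assoc]
      gcongr
      exact le_mul_of_one_le_left (by positivity) (by exact_mod_cast hM1)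
    refine (Finset.sum_le_sum hone).trans ?_
    rw [← Finset.mul_sum, ← ENNReal.ofReal_sum_of_nonneg fun i _ => by positivity, ← Finset.mul_sum]
    gcongr
    exact sum_pow_mul_exp_neg_le hM0 hm p (I + 1)

end AsymptoticDomination

/-! ### The catchment area between two balls. -/

section Sandwich

variable {d m : ℕ} {𝒳 𝒵 : Set (E d)} {φ ψ : E d → E m} {ε η Λ H : ℝ} {N M : ℕ}
  {xs : Fin N → E d} {x z : E d} {S : Finset (E m)}

lemma exists_net_point_near (hS : ∀ y : E m, ‖y‖ ≤ Λ → ∃ s ∈ S, ‖y - s‖ < η) (hH : 0 < H)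
    {c w : E m} (hw : ‖w - c‖ ≤ Λ * H) : ∃ s ∈ S, dist w (c + H • s) ≤ η * H := by
  obtain ⟨s, hs, h⟩ := hS (H⁻¹ • (w - c)) (by
    rw [norm_smul, norm_inv, Real.norm_of_nonneg hH.le, inv_mul_le_iff₀ hH]
    linarith)
  refine ⟨s, hs, ?_⟩
  have h1 : w - (c + H • s) = H • (H⁻¹ • (w - c) - s) := by
    rw [smul_sub, smul_smul, mul_inv_cancel₀ hH.ne', one_smul]
    abel
  rw [dist_eq_norm, h1, norm_smul, Real.norm_of_nonneg hH.le, mul_comm]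
  gcongr

/-- Within distance `ΛH` the increment error is at most `ηH`. The ball of radius `(1 + 2η)H` around
`φ z` contains a net ball with at least `M` points; two increment errors raise the threshold to `(1
+ 4η)H`. -/
lemma mem_ball_of_mem_catchment (hH : 0 < H) (hε : 0 ≤ ε) (hεΛ : ε * Λ ≤ η)
    (hΛ : 0 ≤ Λ) (hS : ∀ y : E m, ‖y‖ ≤ Λ → ∃ s ∈ S, ‖y - s‖ < η)
    (hcount : ∀ s ∈ S, M ≤ hits (Metric.ball (φ x + H • s) ((1 + η) * H)) fun i => φ (xs i))
    (hinc : IncrementBound 𝒳 φ ψ ε (Λ * H))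
    (hM : 1 ≤ M) (hMN : M ≤ N) (hx : x ∈ 𝒳) (hz : z ∈ 𝒳) (hxs : ∀ i, xs i ∈ 𝒳)
    (hzΛ : φ z ∈ Metric.ball (φ x) (Λ * H)) (hzA : z ∈ catchment 𝒵 M ψ xs x) :
    φ z ∈ Metric.ball (φ x) ((1 + 4 * η) * H) := by
  rw [Metric.mem_ball, dist_eq_norm] at hzΛ ⊢
  by_contra hcon
  rw [not_lt] at hcon
  obtain ⟨s, hs, hd⟩ := exists_net_point_near hS hH hzΛ.le
  refine hinc.notMem_catchment (b := (1 + 2 * η) * H) hε hM hMN hx hz hxs ?_ (by positivity)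
    ((hcount s hs).trans (hits_le_hits fun i hi => Metric.ball_subset_ball' ?_ hi)) hzA
  · rw [norm_sub_rev (φ x), max_eq_left hzΛ.le]
    nlinarith
  · rw [dist_comm]
    linarith

/-- The mirror image: the ball of radius `(1 - 2η)H` around `φ z` lies inside a net ball holding
fewer than `M` points. -/
lemma mem_catchment_of_mem_ball (hH : 0 < H) (hη : 0 ≤ η) (hη1 : η ≤ 1) (hε : 0 ≤ ε)
    (hεΛ : ε * Λ ≤ η) (hΛ : 1 ≤ Λ) (hS : ∀ y : E m, ‖y‖ ≤ Λ → ∃ s ∈ S, ‖y - s‖ < η)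
    (hcount : ∀ s ∈ S, hits (Metric.ball (φ x + H • s) ((1 - η) * H)) (fun i => φ (xs i)) < M)
    (hinc : IncrementBound 𝒳 φ ψ ε (Λ * H))
    (hM : 1 ≤ M) (hMN : M ≤ N) (hx : x ∈ 𝒳) (hz : z ∈ 𝒳) (hz' : z ∈ 𝒵) (hxs : ∀ i, xs i ∈ 𝒳)
    (hzH : φ z ∈ Metric.ball (φ x) ((1 - 4 * η) * H)) :
    z ∈ catchment 𝒵 M ψ xs x := by
  rw [Metric.mem_ball, dist_eq_norm] at hzH
  obtain ⟨s, hs, hd⟩ := exists_net_point_near hS hH (c := φ x) (w := φ z) (by nlinarith)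
  refine hinc.mem_catchment (b := (1 - 2 * η) * H) hε (by nlinarith) hM hMN hx hz hz' hxs ?_
    (by positivity) ((hits_le_hits fun i hi => Metric.ball_subset_ball' ?_ hi).trans_lt
      (hcount s hs))
  · rw [norm_sub_rev (φ x), max_eq_left (by nlinarith)]
    nlinarith
  · linarith

end Sandwich

/-! ### Convergence in probability of the ratio estimator. -/

section InProbability

variable {Ω : Type*} [MeasurableSpace Ω] {P : Measure Ω} [IsProbabilityMeasure P] {d m : ℕ}

lemma exists_dilation_close (r : ℝ) (m : ℕ) {η' : ℝ} (hη' : 0 < η') :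
    ∃ η : ℝ, 0 < η ∧ η ≤ 1 / 8 ∧ |r * (1 + 4 * η) ^ m - r| < η' ∧ |r * (1 - 4 * η) ^ m - r| < η' := by
  have h1 : ∀ᶠ η : ℝ in 𝓝[>] 0, |r * (1 + 4 * η) ^ m - r| < η' := by
    have hc : ContinuousAt (fun η : ℝ => |r * (1 + 4 * η) ^ m - r|) 0 := by fun_prop
    refine (hc.eventually_lt_const (by simpa using hη')).filter_mono nhdsWithin_le_nhds
  have h2 : ∀ᶠ η : ℝ in 𝓝[>] 0, |r * (1 - 4 * η) ^ m - r| < η' := by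
    have hc : ContinuousAt (fun η : ℝ => |r * (1 - 4 * η) ^ m - r|) 0 := by fun_prop
    refine (hc.eventually_lt_const (by simpa using hη')).filter_mono nhdsWithin_le_nhds
  have h3 : ∀ᶠ η : ℝ in 𝓝[>] 0, η ∈ Set.Ioo (0 : ℝ) (1 / 8) :=
    Ioo_mem_nhdsGT (by norm_num)
  obtain ⟨η, ha, hb, hc⟩ := (h1.and (h2.and h3)).exists
  exact ⟨η, hc.1, hc.2.le, ha, hb⟩

-- Off a small exceptional set, localization first confines matched points to the ball of radius
-- `ΛH`; the sandwich then compares the matched count with counts in balls of radii `(1 ± 4η)H`,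
-- whose limits are close to `r`.
set_option maxHeartbeats 1000000 in
lemma tendsto_measure_abs_ratioEst_sub (hm : 1 ≤ m) {𝒳 𝒵 : Set (E d)} {φ : E d → E m}
    {X Z : ℕ → Ω → E d} {ν₀ ν₁ : Measure (E m)} [IsProbabilityMeasure ν₀]
    (hY : ∀ i, HasLaw (φ ∘ X i) ν₀ P) (hindY : iIndepFun (fun i => φ ∘ X i) P)
    (hW : ∀ i, HasLaw (φ ∘ Z i) ν₁ P) (hindW : iIndepFun (fun i => φ ∘ Z i) P)
    (hX𝒳 : ∀ᵐ ω ∂P, ∀ i, X i ω ∈ 𝒳) (hZ𝒳 : ∀ᵐ ω ∂P, ∀ j, Z j ω ∈ 𝒳)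
    (hZ𝒵 : ∀ᵐ ω ∂P, ∀ j, Z j ω ∈ 𝒵)
    {f₀ f₁ : E m → ℝ≥0} (hν₀ : ν₀ = volume.withDensity fun u => (f₀ u : ℝ≥0∞))
    (hν₁ : ν₁ = volume.withDensity fun u => (f₁ u : ℝ≥0∞)) {x : E d} (hx : x ∈ 𝒳)
    (hpos : 0 < f₀ (φ x)) (hc₀ : ContinuousAt f₀ (φ x)) (hc₁ : ContinuousAt f₁ (φ x))
    {N₁ M : ℕ → ℕ} (hMn : Tendsto (fun n : ℕ => (M n : ℝ) / n) atTop (𝓝 0))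
    (hMN : Tendsto (fun n : ℕ => (M n : ℝ) * N₁ n / n) atTop atTop)
    (hM : Tendsto M atTop atTop) {p : ℕ} {ψ : ℕ → Ω → E d → E m}
    (hψ : DyadicErrorCondition P 𝒳 φ ψ M p) {η' : ℝ} (hη' : 0 < η') :
    Tendsto (fun n => P {ω | η' < |ratioEst 𝒵 (M n) (ψ n ω) (fun i : Fin n => X i ω)
      (fun j : Fin (N₁ n) => Z j ω) x - f₁ (φ x) / f₀ (φ x)|}) atTop (𝓝 0) := by
  have hf : (0 : ℝ) < f₀ (φ x) := hpos
  set r : ℝ := f₁ (φ x) / f₀ (φ x) with hr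
  set V := volume.real (Metric.ball (0 : E m) 1) with hV
  have hV0 : 0 < V := volume_real_unit_ball_pos m
  obtain ⟨S, hS1, hS⟩ := exists_finset_net m 1 (by norm_num : (0 : ℝ) < 1 / 8)
  obtain ⟨u₀, c₀, C, hu₀, hu₁, hc₀', -, -, hmass⟩ :=
    exists_local_mass_bounds hν₀ hν₁ hpos hc₀ hc₁
  obtain ⟨η, hη, hη8, hηp, hηm⟩ := exists_dilation_close r m (half_pos hη')
  -- Chosen so that `n f₀(φ x) V Hᵐ = M` for `H = a · bandwidth`.
  set a : ℝ := (1 / (V * f₀ (φ x))) ^ (1 / (m : ℝ)) with ha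
  have ha0 : 0 < a := by positivity
  have ham : a ^ m = 1 / (V * f₀ (φ x)) := by
    rw [ha, one_div (m : ℝ), Real.rpow_inv_natCast_pow (by positivity) (by omega)]
  -- The extra `2 * a` ensures `Λ = L / a ≥ 2`, so the localized region contains the balls being
  -- compared.
  set L : ℝ := 1 + 4 / c₀ + 2 * a with hL
  have hcL : 0 < 4 / c₀ := by positivity
  have hL1 : 1 ≤ L := by rw [hL]; linarith
  have hL0 : 0 < L := by linarith
  have hLm1 : 1 ≤ L ^ m := one_le_pow₀ hL1
  have hLm : 4 ≤ c₀ * L ^ m := by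
    have h1 : L ≤ L ^ m := le_self_pow₀ hL1 (by omega)
    have h2 : 4 / c₀ ≤ L ^ m := by linarith
    rw [div_le_iff₀ hc₀'] at h2
    linarith
  set Λ : ℝ := L / a with hΛ
  have hΛ2 : 2 ≤ Λ := by
    rw [hΛ, le_div_iff₀ ha0]
    linarith
  have hΛ0 : 0 < Λ := by linarith
  obtain ⟨S', -, hS'⟩ := exists_finset_net m Λ hη
  set ε : ℝ := min (1 / 32) (η / Λ) with hε
  have hε0 : 0 < ε := by positivity
  have hε32 : ε ≤ 1 / 32 := min_le_left _ _
  have hεΛ : ε * Λ ≤ η := by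
    rw [← le_div_iff₀ hΛ0]
    exact min_le_right _ _
  obtain ⟨e, he, hψe⟩ := hψ ε hε0
  obtain ⟨e', he', hψe'⟩ := hψ (u₀ / 64) (by positivity)
  set H : ℕ → ℝ := fun n => a * bandwidth m M n with hH
  have hMreal : Tendsto (fun n => (M n : ℝ)) atTop atTop := tendsto_natCast_atTop_atTop.comp hM
  have hHm : ∀ n, H n ^ m = a ^ m * (M n / n) := fun n => by
    simp only [hH]
    rw [mul_pow, bandwidth_pow hm]
  have hHpos : ∀ᶠ n in atTop, 0 < H n := by
    filter_upwards [hM.eventually_ge_atTop 1, eventually_ge_atTop 1] with n h1 h2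
    exact mul_pos ha0 (bandwidth_pos h1 h2)
  have hH0 : Tendsto H atTop (𝓝 0) := by
    simpa using (tendsto_bandwidth hm hMn).const_mul a
  have hnH : ∀ᶠ n : ℕ in atTop, (n : ℝ) * H n ^ m = a ^ m * M n := by
    filter_upwards [eventually_ge_atTop 1] with n h1
    have : (0 : ℝ) < n := by exact_mod_cast h1
    rw [hHm]
    field_simp
  have hnHlim : Tendsto (fun n : ℕ => (n : ℝ) * H n ^ m) atTop atTop := by
    refine (hMreal.const_mul_atTop (by positivity : 0 < a ^ m)).congr' ?_
    filter_upwards [hnH] with n h using h.symm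
  have hNHlim : Tendsto (fun n : ℕ => (N₁ n : ℝ) * H n ^ m) atTop atTop := by
    refine (hMN.const_mul_atTop (by positivity : 0 < a ^ m)).congr fun n => ?_
    rw [hHm]
    ring
  -- The distance between the limiting normalized count `(1 - η)ᵐ / aᵐ` and the value `1 / aᵐ`
  -- corresponding to a count of `M`; `θ₂` is its analogue for radius `(1 + η)H`.
  set θ₁ : ℝ := (1 - (1 - η) ^ m) / a ^ m with hθ₁
  have hθ₁0 : 0 < θ₁ := by
    have : (1 - η) ^ m < 1 := pow_lt_one₀ (by linarith) (by linarith) (by omega)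
    exact div_pos (by linarith) (by positivity)
  set θ₂ : ℝ := ((1 + η) ^ m - 1) / a ^ m with hθ₂
  have hθ₂0 : 0 < θ₂ := by
    have : 1 < (1 + η) ^ m := one_lt_pow₀ (by linarith) (by omega)
    exact div_pos (by linarith) (by positivity)
  set θ : ℝ := η' / 2 / a ^ m with hθ
  have hθ0 : 0 < θ := by positivity
  have hA₁ := fun s => tendsto_measure_hits_ball hY hindY hν₀ hc₀ (N := fun n => n) hHpos hH0
    hnHlim s (by linarith : 0 < 1 - η) hθ₁0
  have hA₂ := fun s => tendsto_measure_hits_ball hY hindY hν₀ hc₀ (N := fun n => n) hHpos hH0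
    hnHlim s (by linarith : 0 < 1 + η) hθ₂0
  have hD₁ := tendsto_measure_hits_ball hW hindW hν₁ hc₁ hHpos hH0
    hNHlim 0 (by linarith : 0 < 1 + 4 * η) hθ0
  have hD₂ := tendsto_measure_hits_ball hW hindW hν₁ hc₁ hHpos hH0
    hNHlim 0 (by linarith : 0 < 1 - 4 * η) hθ0
  rw [← hV] at hD₁ hD₂
  simp_rw [← hV] at hA₁ hA₂
  set A₁ : E m → ℕ → Set Ω := fun s n => {ω | θ₁ ≤ |(hits (Metric.ball (φ x + H n • s)
    ((1 - η) * H n)) (fun i : Fin n => (φ ∘ X i) ω) : ℝ) / (n * H n ^ m) -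
      f₀ (φ x) * (V * (1 - η) ^ m)|} with hA₁def
  set A₂ : E m → ℕ → Set Ω := fun s n => {ω | θ₂ ≤ |(hits (Metric.ball (φ x + H n • s)
    ((1 + η) * H n)) (fun i : Fin n => (φ ∘ X i) ω) : ℝ) / (n * H n ^ m) -
      f₀ (φ x) * (V * (1 + η) ^ m)|} with hA₂def
  set D₁ : ℕ → Set Ω := fun n => {ω | θ ≤ |(hits (Metric.ball (φ x + H n • (0 : E m))
    ((1 + 4 * η) * H n)) (fun i : Fin (N₁ n) => (φ ∘ Z i) ω) : ℝ) / (N₁ n * H n ^ m) -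
      f₁ (φ x) * (V * (1 + 4 * η) ^ m)|} with hD₁def
  set D₂ : ℕ → Set Ω := fun n => {ω | θ ≤ |(hits (Metric.ball (φ x + H n • (0 : E m))
    ((1 - 4 * η) * H n)) (fun i : Fin (N₁ n) => (φ ∘ Z i) ω) : ℝ) / (N₁ n * H n ^ m) -
      f₁ (φ x) * (V * (1 - 4 * η) ^ m)|} with hD₂def
  set b : ℕ → ℝ≥0∞ := fun n => e n + e' n + S.card * ENNReal.ofReal (2 / M n) +
    (∑ s ∈ S', (P (A₁ s n) + P (A₂ s n))) + (P (D₁ n) + P (D₂ n)) with hb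
  have hb0 : Tendsto b atTop (𝓝 0) := by
    have h1 : Tendsto (fun n => ENNReal.ofReal (2 / M n)) atTop (𝓝 0) := by
      simpa using ENNReal.tendsto_ofReal (hMreal.const_div_atTop 2)
    have h2 := ENNReal.Tendsto.const_mul h1 (Or.inr (ENNReal.natCast_ne_top S.card))
    have h3 := tendsto_finsetSum S' fun s _ => (hA₁ s).add (hA₂ s)
    have h4 := (((he.add he').add h2).add h3).add (hD₁.add hD₂)
    simp only [mul_zero, add_zero, Finset.sum_const_zero] at h4
    exact h4
  refine tendsto_measure_of_le hb0 ?_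
  have hsmall : ∀ᶠ n in atTop, L * bandwidth m M n ≤ u₀ := by
    have := (tendsto_bandwidth hm hMn).const_mul L
    rw [mul_zero] at this
    exact this.eventually_le_const hu₀
  filter_upwards [hM.eventually_ge_atTop 1, hMn.eventually_le_const one_pos,
    hMN.eventually_gt_atTop 0, hsmall, eventually_ge_atTop 1, hnH] with n hM1 hMn1 hN1 htu hn1 hnHn
  have hn0 : (0 : ℝ) < n := by exact_mod_cast hn1
  have hM0 : (0 : ℝ) < M n := by exact_mod_cast hM1
  have hMle : M n ≤ n := by
    rw [div_le_one hn0] at hMn1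
    exact_mod_cast hMn1
  have hK1 : 1 ≤ N₁ n := by
    by_contra hcon
    have : N₁ n = 0 := by omega
    simp [this] at hN1
  have hK0 : (0 : ℝ) < N₁ n := by exact_mod_cast hK1
  have hh := bandwidth_pos (m := m) hM1 hn1
  have hHn : 0 < H n := mul_pos ha0 hh
  set t : ℝ := L * bandwidth m M n with ht
  have ht0 : 0 < t := by positivity
  have htΛ : t = Λ * H n := by
    simp only [ht, hΛ, hH]
    field_simp
  have htm : t ^ m = L ^ m * (M n / n) := by rw [ht, mul_pow, bandwidth_pow hm]
  have hGt : (n : ℝ) / M n * t ^ m = L ^ m := by rw [htm]; field_simp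
  obtain ⟨I, hI1, hI2⟩ := exists_nat_dyadic ht0 htu
  have hti : ∀ i ≤ I, 2 ^ i * t ≤ u₀ := fun i hi => by
    refine le_trans ?_ hI1
    gcongr
    norm_num
  have hct : 4 * (M n : ℝ) ≤ n * (c₀ * t ^ m) := by
    rw [htm]
    have : (n : ℝ) * (c₀ * (L ^ m * (M n / n))) = c₀ * L ^ m * M n := by field_simp
    rw [this]
    gcongr
  set F : Set Ω := {ω | ¬ IncrementBound 𝒳 φ (ψ n ω) ε t} with hF
  set G : Set Ω := {ω | ¬ ∀ s ∈ 𝒳, ‖ψ n ω s - φ s‖ ≤ u₀ / 64} with hG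
  set B : ℕ → Set Ω := fun i => {ω | ∃ s ∈ S, hits (Metric.ball (φ x + (2 ^ i * t) • s)
    (2 ^ i * t / 4)) (fun j : Fin n => (φ ∘ X j) ω) < M n} with hB
  have hPF : P F ≤ e n := by
    -- A single scale suffices: the weight in the error condition is then `(Lᵐ)ᵖ ≥ 1`, so the bare
    -- probability is bounded too.
    have h1 := (hψe n).1 t 0 ht0 (by simpa using htu.trans hu₁)
    simp only [zero_add, Finset.range_one, Finset.sum_singleton, pow_zero, one_mul] at h1
    refine le_trans (le_mul_of_one_le_left zero_le ?_) h1
    rw [hGt, ENNReal.one_le_ofReal]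
    exact one_le_pow₀ hLm1
  have hPG : P G ≤ e' n := by
    refine le_trans (le_mul_of_one_le_left zero_le ?_) (hψe' n).2
    rw [ENNReal.one_le_ofReal]
    refine one_le_pow₀ ?_
    rw [one_le_div hM0]
    exact_mod_cast hMle
  have hPB : P (⋃ i ∈ Finset.range (I + 1), B i) ≤ S.card * ENNReal.ofReal (2 / M n) := by
    refine (measure_biUnion_finset_le _ _).trans ?_
    refine (Finset.sum_le_sum fun i hi => measure_exists_hits_lt_le hY hindY (fun s hs =>
      (hmass _ (by positivity) (hti i (Nat.lt_succ_iff.1 (Finset.mem_range.1 hi)))).1 s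
        (hS1 s hs)) hct).trans ?_
    rw [← Finset.mul_sum, ← ENNReal.ofReal_sum_of_nonneg fun i _ => by positivity]
    gcongr
    exact sum_exp_neg_le hM0 hm _
  have hPA : P (⋃ s ∈ S', (A₁ s n ∪ A₂ s n)) ≤ ∑ s ∈ S', (P (A₁ s n) + P (A₂ s n)) :=
    (measure_biUnion_finset_le _ _).trans (Finset.sum_le_sum fun s _ => measure_union_le _ _)
  have hunion : P {ω | η' < |ratioEst 𝒵 (M n) (ψ n ω) (fun i : Fin n => X i ω)
      (fun j : Fin (N₁ n) => Z j ω) x - r|} ≤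
      P (F ∪ G ∪ (⋃ i ∈ Finset.range (I + 1), B i) ∪ (⋃ s ∈ S', (A₁ s n ∪ A₂ s n)) ∪
        (D₁ n ∪ D₂ n)) := by
    refine measure_mono_ae ?_
    filter_upwards [hX𝒳, hZ𝒳, hZ𝒵] with ω hXω hZω hZω' hω
    by_contra hcon
    have hcon' : ω ∉ F ∪ G ∪ (⋃ i ∈ Finset.range (I + 1), B i) ∪ (⋃ s ∈ S', (A₁ s n ∪ A₂ s n)) ∪
        (D₁ n ∪ D₂ n) := hcon
    simp only [Set.mem_union, Set.mem_iUnion, not_or, not_exists, Finset.mem_range] at hcon'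
    obtain ⟨⟨⟨⟨hnF, hnG⟩, hnB⟩, hnA⟩, hnD₁, hnD₂⟩ := hcon'
    have hinc : IncrementBound 𝒳 φ (ψ n ω) ε t := not_not.1 hnF
    have hsup : ∀ s ∈ 𝒳, ‖ψ n ω s - φ s‖ ≤ u₀ / 64 := not_not.1 hnG
    have hball : ∀ k, 0 ≤ k → k ≤ I → ∀ s ∈ S, M n ≤ hits (Metric.ball
        (φ x + (2 ^ k * t) • s) (2 ^ k * t / 4)) fun i : Fin n => φ (X i ω) := by
      intro k _ hk s hs
      by_contra hlt
      exact hnB k (Nat.lt_succ_iff.2 hk) ⟨s, hs, not_le.1 hlt⟩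
    have hf₀V : ∀ β : ℝ, f₀ (φ x) * (V * β ^ m) = β ^ m / a ^ m := fun β => by
      rw [ham]; field_simp
    have hcount₁ : ∀ s ∈ S', hits (Metric.ball (φ x + H n • s) ((1 - η) * H n))
        (fun i : Fin n => φ (X i ω)) < M n := by
      intro s hs
      by_contra hge
      refine (hnA s hs).1 ?_
      have hge' : (M n : ℝ) ≤ (hits (Metric.ball (φ x + H n • s) ((1 - η) * H n))
        (fun i : Fin n => φ (X i ω)) : ℝ) := by exact_mod_cast not_lt.1 hge
      simp only [hA₁def, Set.mem_ofPred_eq, Function.comp_apply]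
      refine le_trans ?_ (le_abs_self _)
      rw [hnHn, hf₀V, hθ₁, sub_div]
      gcongr ?_ - _
      rw [div_le_div_iff₀ (by positivity) (by positivity)]
      rw [one_mul, mul_comm]
      gcongr
    have hcount₂ : ∀ s ∈ S', M n ≤ hits (Metric.ball (φ x + H n • s) ((1 + η) * H n))
        (fun i : Fin n => φ (X i ω)) := by
      intro s hs
      by_contra hlt
      refine (hnA s hs).2 ?_
      have hlt' : (hits (Metric.ball (φ x + H n • s) ((1 + η) * H n))
        (fun i : Fin n => φ (X i ω)) : ℝ) ≤ M n := by exact_mod_cast (not_le.1 hlt).le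
      simp only [hA₂def, Set.mem_ofPred_eq, Function.comp_apply]
      refine le_trans ?_ (neg_le_abs _)
      rw [hnHn, hf₀V, hθ₂, neg_sub, sub_div]
      gcongr _ - ?_
      rw [div_le_div_iff₀ (by positivity) (by positivity)]
      rw [one_mul, mul_comm (a ^ m)]
      gcongr
    rw [htΛ] at hinc
    have hup : hits (catchment 𝒵 (M n) (ψ n ω) (fun i : Fin n => X i ω) x)
        (fun j : Fin (N₁ n) => Z j ω) ≤ hits (Metric.ball (φ x + H n • (0 : E m))
          ((1 + 4 * η) * H n)) (fun j : Fin (N₁ n) => φ (Z j ω)) := by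
      refine hits_le_hits fun j hj => ?_
      rw [smul_zero, add_zero]
      have hloc := norm_lt_of_mem_catchment hS ht0 (Nat.zero_le I) hε0.le hε32
        (by rw [pow_zero, one_mul, htΛ]; exact hinc) hball
        (by rw [pow_succ] at hI2; linarith) hsup hM1 hMle hx (hZω j) (fun i => hXω i) hj
      rw [pow_zero, one_mul, htΛ] at hloc
      exact mem_ball_of_mem_catchment hHn hε0.le hεΛ hΛ0.le hS' hcount₂ hinc hM1 hMle hx
        (hZω j) (fun i => hXω i) hloc hj
    have hlo : hits (Metric.ball (φ x + H n • (0 : E m)) ((1 - 4 * η) * H n))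
        (fun j : Fin (N₁ n) => φ (Z j ω)) ≤
        hits (catchment 𝒵 (M n) (ψ n ω) (fun i : Fin n => X i ω) x)
          (fun j : Fin (N₁ n) => Z j ω) := by
      refine hits_le_hits fun j hj => ?_
      rw [smul_zero, add_zero] at hj
      exact mem_catchment_of_mem_ball hHn hη.le (by linarith) hε0.le hεΛ (by linarith) hS' hcount₁
        hinc hM1 hMle hx (hZω j) (hZω' j) (fun i => hXω i) hj
    have hR : ∀ k : ℝ, (n : ℝ) / N₁ n * (k / M n) = a ^ m * (k / (N₁ n * H n ^ m)) := fun k => by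
      rw [hHm]; field_simp
    have hrV : ∀ β : ℝ, a ^ m * (f₁ (φ x) * (V * β ^ m)) = r * β ^ m := fun β => by
      rw [ham, hr]; field_simp
    have hdev : ∀ k β : ℝ, ¬ θ ≤ |k / (N₁ n * H n ^ m) - f₁ (φ x) * (V * β ^ m)| →
        |(n : ℝ) / N₁ n * (k / M n) - r * β ^ m| < η' / 2 := by
      intro k β hk
      rw [hR, ← hrV, ← mul_sub, abs_mul, abs_of_pos (by positivity), mul_comm, ← lt_div_iff₀
        (by positivity)]
      exact not_le.1 hk
    have h1 := abs_lt.1 (hdev _ _ hnD₁)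
    have h2 := abs_lt.1 (hdev _ _ hnD₂)
    have hup' : (n : ℝ) / N₁ n * ((hits (catchment 𝒵 (M n) (ψ n ω) (fun i : Fin n => X i ω) x)
        (fun j : Fin (N₁ n) => Z j ω) : ℝ) / M n) ≤ (n : ℝ) / N₁ n *
          ((hits (Metric.ball (φ x + H n • (0 : E m)) ((1 + 4 * η) * H n))
            (fun j : Fin (N₁ n) => φ (Z j ω)) : ℝ) / M n) := by gcongr
    have hlo' : (n : ℝ) / N₁ n * ((hits (Metric.ball (φ x + H n • (0 : E m)) ((1 - 4 * η) * H n))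
        (fun j : Fin (N₁ n) => φ (Z j ω)) : ℝ) / M n) ≤ (n : ℝ) / N₁ n *
          ((hits (catchment 𝒵 (M n) (ψ n ω) (fun i : Fin n => X i ω) x)
            (fun j : Fin (N₁ n) => Z j ω) : ℝ) / M n) := by gcongr
    have h3 := abs_lt.1 hηp
    have h4 := abs_lt.1 hηm
    have hω' : η' < |ratioEst 𝒵 (M n) (ψ n ω) (fun i : Fin n => X i ω)
      (fun j : Fin (N₁ n) => Z j ω) x - r| := hω
    rw [ratioEst, matchCount_eq_hits] at hω'
    refine absurd hω' (not_lt.2 (abs_le.2 ⟨?_, ?_⟩))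
    · simp only [Function.comp_apply] at h2
      linarith [h2.1, h4.1]
    · simp only [Function.comp_apply] at h1
      linarith [h1.2, h3.2]
  refine hunion.trans ?_
  refine (measure_union_le _ _).trans (add_le_add ?_ (measure_union_le _ _))
  refine (measure_union_le _ _).trans (add_le_add ?_ hPA)
  refine (measure_union_le _ _).trans (add_le_add ?_ hPB)
  exact (measure_union_le _ _).trans (add_le_add hPF hPG)

end InProbability

/-! ### From convergence in probability to convergence of moments. -/

section Moments

variable {Ω : Type*} [MeasurableSpace Ω] {P : Measure Ω}

lemma tendsto_measure_abs_pow_sub {R : ℕ → Ω → ℝ} {r : ℝ}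
    (hprob : ∀ η : ℝ, 0 < η → Tendsto (fun n => P {ω | η < |R n ω - r|}) atTop (𝓝 0)) (p : ℕ)
    {η : ℝ} (hη : 0 < η) : Tendsto (fun n => P {ω | η < |R n ω ^ p - r ^ p|}) atTop (𝓝 0) := by
  obtain ⟨δ, hδ, hcont⟩ := Metric.continuousAt_iff.1
    ((continuous_pow p).continuousAt (x := r)) η hη
  refine tendsto_measure_of_le (hprob (δ / 2) (half_pos hδ))
    (Eventually.of_forall fun n => measure_mono fun ω hω => ?_)
  by_contra hcon
  have h1 : |R n ω - r| ≤ δ / 2 := not_lt.1 hcon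
  have h2 : |R n ω ^ p - r ^ p| < η := by
    have := hcont (x := R n ω) (by rw [Real.dist_eq]; linarith)
    rwa [Real.dist_eq] at this
  exact absurd hω (not_lt.2 h2.le)

/-- On the event where `Rᵖ` is far from `rᵖ`, the difference is at most `rᵖ + C + Y`. The constant
is multiplied by a vanishing probability and `∫ Y → 0`, so convergence holds in `L¹`. -/
lemma tendsto_integral_pow_of_domination [IsProbabilityMeasure P] {R : ℕ → Ω → ℝ} (hR : ∀ n ω, 0 ≤ R n ω)
    (hRm : ∀ᶠ n in atTop, AEMeasurable (R n) P) {r : ℝ} (hr : 0 ≤ r)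
    (hprob : ∀ η : ℝ, 0 < η → Tendsto (fun n => P {ω | η < |R n ω - r|}) atTop (𝓝 0)) {p : ℕ}
    {C : ℝ} (hC : 0 ≤ C) {b : ℕ → ℝ≥0∞} (hb : Tendsto b atTop (𝓝 0))
    (hdom : ∀ᶠ n in atTop, ∃ Y : Ω → ℝ≥0∞, AEMeasurable Y P ∧
      (∀ᵐ ω ∂P, ENNReal.ofReal (R n ω ^ p) ≤ ENNReal.ofReal C + Y ω) ∧ ∫⁻ ω, Y ω ∂P ≤ b n) :
    Tendsto (fun n => ∫ ω, R n ω ^ p ∂P) atTop (𝓝 (r ^ p)) := by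
  have hint : ∀ᶠ n in atTop, Integrable (fun ω => R n ω ^ p) P := by
    filter_upwards [hRm, hdom, hb.eventually_lt_const zero_lt_one] with n hm hY hbn
    obtain ⟨Y, hYm, hYle, hYint⟩ := hY
    refine ⟨(hm.pow_const p).aestronglyMeasurable, ?_⟩
    have hle : ∫⁻ ω, ‖R n ω ^ p‖ₑ ∂P ≤ ENNReal.ofReal C + b n := by
      calc ∫⁻ ω, ‖R n ω ^ p‖ₑ ∂P ≤ ∫⁻ ω, (ENNReal.ofReal C + Y ω) ∂P := by
            refine lintegral_mono_ae ?_
            filter_upwards [hYle] with ω h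
            rwa [Real.enorm_of_nonneg (pow_nonneg (hR n ω) p)]
        _ = ENNReal.ofReal C + ∫⁻ ω, Y ω ∂P := by
            rw [lintegral_add_left measurable_const]
            simp
        _ ≤ _ := by gcongr
    exact hle.trans_lt (ENNReal.add_lt_top.2 ⟨ENNReal.ofReal_lt_top, hbn.trans ENNReal.one_lt_top⟩)
  have hL1 : Tendsto (fun n => ∫⁻ ω, ‖R n ω ^ p - r ^ p‖ₑ ∂P) atTop (𝓝 0) := by
    rw [ENNReal.tendsto_nhds_zero]
    intro ε hε
    by_cases hεtop : ε = ∞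
    · simp [hεtop]
    have hε0 : 0 < ε.toReal := ENNReal.toReal_pos hε.ne' hεtop
    have hη : 0 < ε.toReal / 2 := half_pos hε0
    have hmain := (ENNReal.Tendsto.const_mul (tendsto_measure_abs_pow_sub hprob p hη)
      (Or.inr (ENNReal.ofReal_ne_top (r := r ^ p + C)))).add hb
    simp only [mul_zero, add_zero] at hmain
    have hpos : 0 < ENNReal.ofReal (ε.toReal / 2) := ENNReal.ofReal_pos.2 hη
    filter_upwards [hdom, hmain.eventually_le_const hpos] with n hY hn
    obtain ⟨Y, hYm, hYle, hYint⟩ := hY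
    set B : Set Ω := toMeasurable P {ω | ε.toReal / 2 < |R n ω ^ p - r ^ p|} with hB
    have hBm : Measurable fun ω => ENNReal.ofReal (r ^ p + C) *
        B.indicator (fun _ => (1 : ℝ≥0∞)) ω :=
      (measurable_const.indicator (measurableSet_toMeasurable _ _)).const_mul _
    calc ∫⁻ ω, ‖R n ω ^ p - r ^ p‖ₑ ∂P
        ≤ ∫⁻ ω, (ENNReal.ofReal (ε.toReal / 2) +
            (ENNReal.ofReal (r ^ p + C) * B.indicator (fun _ => (1 : ℝ≥0∞)) ω + Y ω)) ∂P := by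
          refine lintegral_mono_ae ?_
          filter_upwards [hYle] with ω h
          by_cases hω : ε.toReal / 2 < |R n ω ^ p - r ^ p|
          · have hωB : ω ∈ B := subset_toMeasurable P _ hω
            rw [Set.indicator_of_mem hωB, mul_one]
            refine le_add_left ?_
            rw [ENNReal.ofReal_add (by positivity) hC, add_assoc]
            refine (enorm_sub_le).trans ?_
            rw [Real.enorm_of_nonneg (pow_nonneg (hR n ω) p), Real.enorm_of_nonneg (by positivity),
              add_comm]
            gcongr
          · refine le_add_right ?_
            rw [Real.enorm_eq_ofReal_abs]
            exact ENNReal.ofReal_le_ofReal (not_lt.1 hω)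
      _ = ENNReal.ofReal (ε.toReal / 2) + (ENNReal.ofReal (r ^ p + C) *
            P {ω | ε.toReal / 2 < |R n ω ^ p - r ^ p|} + ∫⁻ ω, Y ω ∂P) := by
          rw [lintegral_add_left measurable_const, lintegral_add_left hBm,
            lintegral_const_mul' _ _ ENNReal.ofReal_ne_top,
            lintegral_indicator_const (measurableSet_toMeasurable _ _), measure_toMeasurable]
          simp
      _ ≤ ENNReal.ofReal (ε.toReal / 2) + ENNReal.ofReal (ε.toReal / 2) := by
          gcongr
          exact (add_le_add le_rfl hYint).trans hn
      _ = ε := by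
          rw [← ENNReal.ofReal_add hη.le hη.le, add_halves, ENNReal.ofReal_toReal hεtop]
  have := tendsto_integral_of_L1 (fun _ => r ^ p) 
    aestronglyMeasurable_const hint hL1
  simpa using this

end Moments

/-! ### Laws, supports and measurability of the estimator. -/

lemma ae_forall_mem_support {Ω : Type*} [MeasurableSpace Ω] {P : Measure Ω} {d : ℕ}
    {X : ℕ → Ω → E d} {μ : Measure (E d)} (hX : ∀ i, HasLaw (X i) μ P) :
    ∀ᵐ ω ∂P, ∀ i, X i ω ∈ μ.support := by
  rw [ae_all_iff]
  intro i
  refine ae_of_ae_map (hX i).aemeasurable ?_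
  rw [(hX i).map_eq]
  exact Measure.support_mem_ae

lemma hasLaw_comp_map {Ω : Type*} [MeasurableSpace Ω] {P : Measure Ω} {d m : ℕ} {X : Ω → E d}
    {μ : Measure (E d)} (hX : HasLaw X μ P) {φ : E d → E m} (hφ : Measurable φ) :
    HasLaw (φ ∘ X) (μ.map φ) P where
  aemeasurable := hφ.comp_aemeasurable hX.aemeasurable
  map_eq := by
    rw [← AEMeasurable.map_map_of_aemeasurable hφ.aemeasurable hX.aemeasurable, hX.map_eq]

lemma aemeasurable_ratioEst_fitted {Ω : Type*} [MeasurableSpace Ω] {P : Measure Ω} {d m : ℕ}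
    {N₁ : ℕ → ℕ} {X Z : ℕ → Ω → E d} (hX : ∀ i, AEMeasurable (X i) P)
    (hZ : ∀ j, AEMeasurable (Z j) P) {𝒵 : Set (E d)} (h𝒵 : MeasurableSet 𝒵)
    {φhat : Estimator d m N₁} {n M : ℕ}
    (hφhat : Measurable fun w : (Fin n → E d) × (Fin (N₁ n) → E d) × E d =>
      φhat n w.1 w.2.1 w.2.2) (hM : 1 ≤ M) (hMn : M ≤ n) (x : E d) :
    AEMeasurable (fun ω => ratioEst 𝒵 M (fitted φhat X Z n ω) (fun i : Fin n => X i ω)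
      (fun j : Fin (N₁ n) => Z j ω) x) P := by
  have hdata : AEMeasurable (fun ω => ((fun i : Fin n => X i ω), fun j : Fin (N₁ n) => Z j ω)) P :=
    (aemeasurable_pi_lambda (fun ω (i : Fin n) => X i ω) fun i => hX i).prodMk
      (aemeasurable_pi_lambda (fun ω (j : Fin (N₁ n)) => Z j ω) fun j => hZ j)
  have hest := measurable_ratioEst hM hMn h𝒵
    (Ψ := fun w : (Fin n → E d) × (Fin (N₁ n) → E d) × E d => φhat n w.1 w.2.1 w.2.2) hφhat x
  have hcomp := hest.comp_aemeasurable hdata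
  simp only [Function.comp_def] at hcomp
  exact hcomp

end

end MatchingRatio

/-! ### The limit of the moments. -/

open MatchingRatio in
theorem mainTheorem5 {d m : ℕ} (hm : 1 ≤ m)
    {Ω : Type*} [MeasurableSpace Ω] (P : Measure Ω) [IsProbabilityMeasure P]
    -- the laws of `X` and `Z`, with supports `𝒳` and `𝒵 ⊆ 𝒳`
    (μ₀ μ₁ : Measure (E d)) [IsProbabilityMeasure μ₀] [IsProbabilityMeasure μ₁]
    (hsupp : μ₁.support ⊆ μ₀.support)
    -- the transformation and the densities of `φ(X)` and `φ(Z)`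
    (φ : E d → E m) (hφ : Measurable φ)
    (f₀ f₁ : E m → ℝ≥0) (hf₀ : Measurable f₀) (hf₁ : Measurable f₁)
    (hν₀ : μ₀.map φ = volume.withDensity (fun u => (f₀ u : ℝ≥0∞)))
    (hν₁ : μ₁.map φ = volume.withDensity (fun u => (f₁ u : ℝ≥0∞)))
    (hac : μ₁.map φ ≪ μ₀.map φ)
    -- the two mutually independent i.i.d. samples
    (X Z : ℕ → Ω → E d) (hX : ∀ i, HasLaw (X i) μ₀ P) (hZ : ∀ j, HasLaw (Z j) μ₁ P)
    (hindep : iIndepFun (Sum.elim X Z) P)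
    -- the sequences `N₁` and `M`, indexed by `N₀`
    (N₁ M : ℕ → ℕ)
    (hMlog : Tendsto (fun n : ℕ => (M n : ℝ) * Real.log n / n) atTop (𝓝 0))
    (hMN : Tendsto (fun n : ℕ => (M n : ℝ) * N₁ n / n) atTop atTop)
    (hM : Tendsto M atTop atTop)
    -- the estimator of `φ`, which may also depend on the target point (its first argument)
    (φhat : E d → Estimator d m N₁)
    (hφhat : ∀ x n, Measurable (fun w : (Fin n → E d) × (Fin (N₁ n) → E d) × E d =>
      φhat x n w.1 w.2.1 w.2.2))
    (p : ℕ) (hp : 1 ≤ p)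
    (x : E d) (hx : x ∈ μ₀.support)
    (hasm : (∃ q, 1 ≤ q ∧ q ≤ m ∧
        UniformErrorCondition P μ₀.support μ₁.support φ (φhat x) X Z M p q) ∨
      OscillationCondition P μ₀.support μ₁.support φ (φhat x) X Z M p)
    (hpos : 0 < f₀ (φ x)) (hc₀ : ContinuousAt f₀ (φ x)) (hc₁ : ContinuousAt f₁ (φ x)) :
    Tendsto (fun n : ℕ => ∫ ω, ratioEst μ₁.support (M n) (fitted (φhat x) X Z n ω)
        (fun i : Fin n => X i ω) (fun j : Fin (N₁ n) => Z j ω) x ^ p ∂P)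
      atTop (𝓝 (((f₁ (φ x) / f₀ (φ x) : ℝ≥0) : ℝ) ^ p)) := by
  have hMn := tendsto_div_of_tendsto_mul_log_div hMlog
  have hX𝒳 := ae_forall_mem_support hX
  have hZ𝒵 := ae_forall_mem_support hZ
  have hZ𝒳 : ∀ᵐ ω ∂P, ∀ j, Z j ω ∈ μ₀.support := hZ𝒵.mono fun ω h j => hsupp (h j)
  have hY := fun i => hasLaw_comp_map (hX i) hφ
  have hW := fun i => hasLaw_comp_map (hZ i) hφ
  have hindX : iIndepFun X P := hindep.precomp (g := Sum.inl) Sum.inl_injective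
  have hindZ : iIndepFun Z P := hindep.precomp (g := Sum.inr) Sum.inr_injective
  have hindY : iIndepFun (fun i => φ ∘ X i) P := hindX.comp (fun _ => φ) fun _ => hφ
  have hindW : iIndepFun (fun i => φ ∘ Z i) P := hindZ.comp (fun _ => φ) fun _ => hφ
  have : IsProbabilityMeasure (μ₀.map φ) := Measure.isProbabilityMeasure_map hφ.aemeasurable
  have : IsProbabilityMeasure (μ₁.map φ) := Measure.isProbabilityMeasure_map hφ.aemeasurable
  have hψ : DyadicErrorCondition P μ₀.support φ (fitted (φhat x) X Z) M p := by
    rcases hasm with ⟨q, hq, hqm, h⟩ | h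
    · exact h.dyadicErrorCondition hp hq hqm hZ𝒵
    · exact h.dyadicErrorCondition hm hp hZ𝒵
  obtain ⟨C, b, hC, hb, hdom⟩ := exists_asymptotic_domination (𝒵 := μ₁.support) hm hY hindY hW hindW
    hX𝒳 hZ𝒳 hν₀ hν₁ hx hpos hc₀ hc₁ hMn hMN hM hp hψ
  have hprob := fun (η : ℝ) (hη : 0 < η) => tendsto_measure_abs_ratioEst_sub (𝒵 := μ₁.support) hm hY
    hindY hW hindW hX𝒳 hZ𝒳 hZ𝒵 hν₀ hν₁ hx hpos hc₀ hc₁ hMn hMN hM hψ hη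
  rw [NNReal.coe_div]
  refine tendsto_integral_pow_of_domination (fun n ω => ratioEst_nonneg _ _ _ _ _ _) ?_
    (by positivity) hprob hC hb hdom
  -- The count description of the matching radius requires `1 ≤ M ≤ N₀`, so measurability is
  -- obtained only for large `N₀`.
  filter_upwards [hM.eventually_ge_atTop 1, hMn.eventually_le_const one_pos,
    eventually_ge_atTop 1] with n hM1 hMn1 hn1
  have hMle : M n ≤ n := by
    rw [div_le_one (by exact_mod_cast hn1)] at hMn1
    exact_mod_cast hMn1
  exact aemeasurable_ratioEst_fitted (fun i => (hX i).aemeasurable) (fun j => (hZ j).aemeasurable)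
    Measure.isClosed_support.measurableSet (hφhat x n) hM1 hMle x
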